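/- \textbf{Setting (beta-Bernoulli bandit alignment problem).} Let $N\ge 1$ and let $\mathcal A=\mathcal A_e\cup\mathcal A_h$, where $\mathcal A_e=\{1,\dots,N\}$ (pull an arm) and $\mathcal A_h=\{\bar 1,\dots,\bar N\}$ (query the human about an arm), so $|\mathcal A|=2N$. The unknown parameters $\theta=(\theta_{\bar a})_{\bar a\in\mathcal A_h}$ and $\phi=(\phi_a)_{a\in\mathcal A_e}$ have $2N$ independent coordinates, each with the $\mathrm{beta}(1,1)$ distribution. An agent $\pi$ maps each history $H_t=(A_0,O_1,\dots,A_{t-1},O_t)$ to a probability distribution on $\mathcal A$; at each time $t=0,1,2,\dots$ it draws $A_t\sim\pi(\cdot\mid H_t)$ and observes $O_{t+1}\in\{0,1\}$, which given $(\theta,\phi,H_t,A_t)$ is $\mathrm{Bernoulli}(\phi_a)$ if $A_t=a\in\mathcal A_e$ and $\mathrm{Bernoulli}(\theta_{\bar a})$ if $A_t=\bar a\in\mathcal A_h$. The (unobserved) reward is $R_{t+1}=\mathcal R(A_t,O_{t+1},\theta)$, where $\mathcal R(a,o,\theta)=o\,\theta_{\bar a}+(1-o)(1-\theta_{\bar a})$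 for $a\in\mathcal A_e$ and $\mathcal R(\bar a,o,\theta)=-1$ for $\bar a\in\mathcal A_h$. Let $R^*=\max_{a\in\mathcal A}\mathbb E[R_{t+1}\mid\theta,\phi,A_t=a]$, and let the regret of $\pi$ at horizon $T$ be $$\Re(\pi,T)=\sum_{t=0}^{T-1}\mathbb E_\pi\left[R^*-R_{t+1}\right].$$ For a probability mass function $p$ on $\mathcal A$, the conditional information ratio at time $t$ is $$\Gamma_t(p)=\frac{\left(\mathbb E\left[R^*-R_{t+1}\mid H_t\right]\right)^2}{\mathbb I(\theta,\phi;A_t,O_{t+1}\mid H_t=H_t)},\qquad A_t\sim p,$$ where the mutual information, in nats, is computed under the conditional law given the realized history. An information-directed sampling (IDS) agent $\pi_{\rm ids}$ is an agent such that, at every time $t$ and every history $H_t$ that occurs with positive probability, $\pi_{\rm ids}(\cdot\mid H_t)$ minimizes $\Gamma_t(p)$ over all probability mass functions $p$ on $\mathcal A$. \textbf{Theorem.} For every IDS agent $\pi_{\rm ids}$, every integer $T\ge 0$ and every $\epsilon\in(0,1)$ (which may depend on $T$), $$\Re(\pi_{\rm ids},T)\ \le\ \sqrt{\frac{|\mathcal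 A|\,T(1-\epsilon)^2}{\min\{\epsilon,1-\epsilon\}}+32\epsilon^2T^2}\cdot\sqrt{|\mathcal A|\ln(4T)},$$ where for $T=0$ both sides are read as $0$. -/

import Mathlib

open MeasureTheory ProbabilityTheory InformationTheory
open scoped unitInterval ENNReal

namespace BanditAlignment

/-- The actions of the problem with `N` arms: `Sum.inl a` pulls the arm `a` (environment action),
`Sum.inr a` queries the human about the arm `a` (the action written `ā`). -/
abbrev Action (N : ℕ) : Type := Fin N ⊕ Fin N

instance (N : ℕ) : DiscreteMeasurableSpace (Action N) where
  forall_measurableSet _ :=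
    measurableSet_sum_iff.2 ⟨MeasurableSet.of_discrete, MeasurableSet.of_discrete⟩

/-- The unknown parameters `(θ, φ)`: `θ a` is the human's preference for the arm `a`, and `φ a` is
the outcome probability of the arm `a`. -/
abbrev Params (N : ℕ) : Type := (Fin N → I) × (Fin N → I)

/-- The history `(A₀, O₁, …, A_{t-1}, O_t)`, as `t` pairs of an action and the observation that
follows it. The observation `1` is `true` and the observation `0` is `false`. -/
abbrev Hist (N t : ℕ) : Type := Fin t → Action N × Bool

/-- An agent maps every history to a probability distribution over the actions. -/
abbrev Agent (N : ℕ) : Type := ∀ t : ℕ, Hist N t → PMF (Action N)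

/-- The beta(1,1) distribution, as a measure on the unit interval, which carries all its mass. -/
noncomputable def betaPrior : Measure I := (betaMeasure 1 1).comap Subtype.val

instance : IsProbabilityMeasure betaPrior where
  measure_univ := by
    have : IsProbabilityMeasure (betaMeasure 1 1) := isProbabilityMeasureBeta one_pos one_pos
    rw [betaPrior, (MeasurableEmbedding.subtype_coe measurableSet_Icc).comap_apply, Set.image_univ,
      Subtype.range_coe]
    refine (prob_compl_eq_zero_iff measurableSet_Icc).1 ?_
    rw [betaMeasure, withDensity_apply _ measurableSet_Icc.compl,
      setLIntegral_eq_zero measurableSet_Icc.compl]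
    intro x hx
    by_cases h : x ≤ 0
    · exact betaPDF_eq_zero_of_nonpos h
    · refine betaPDF_eq_zero_of_one_le ?_
      by_contra h1
      exact hx ⟨by linarith, by linarith⟩

/-- The prior law of `(θ, φ)`: all the coordinates are independent and beta(1,1) distributed. -/
noncomputable def prior (N : ℕ) : Measure (Params N) :=
  (Measure.pi fun _ => betaPrior).prod (Measure.pi fun _ => betaPrior)

instance (N : ℕ) : IsProbabilityMeasure (prior N) := by
  unfold prior; infer_instance

/-- The success probability of the observation that follows an action: `φ a` for pulling the
arm `a`, and `θ a` for querying the human about it. -/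
def successProb {N : ℕ} (x : Params N) : Action N → I
  | Sum.inl a => x.2 a
  | Sum.inr a => x.1 a

/-- The law of the observation, given the parameters and the action. -/
noncomputable def obsKernel (N : ℕ) : Kernel (Params N × Action N) Bool where
  toFun z := bernoulliMeasure true false (successProb z.1 z.2)
  measurable' := by
    refine measurable_from_prod_countable_left fun a => ?_
    have h : Measurable fun x : Params N => successProb x a := by
      cases a
      · exact (measurable_pi_apply _).comp measurable_snd
      · exact (measurable_pi_apply _).comp measurable_fst
    refine Measurable.comp (g := fun p : I => bernoulliMeasure true false p) ?_ h
    refine Measure.measurable_of_measurable_coe _ fun s _ => ?_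
    classical
    simp_rw [bernoulliMeasure_apply _ (MeasurableSet.of_discrete : MeasurableSet s)]
    split_ifs <;> fun_prop

instance (N : ℕ) : IsMarkovKernel (obsKernel N) where
  isProbabilityMeasure z :=
    inferInstanceAs (IsProbabilityMeasure (bernoulliMeasure true false (successProb z.1 z.2)))

/-- The law of (action, observation), given the parameters, when the action is drawn from `p`. -/
noncomputable def roundKernel {N : ℕ} (p : PMF (Action N)) :
    Kernel (Params N) (Action N × Bool) :=
  Kernel.const (Params N) p.toMeasure ⊗ₖ obsKernel N

instance {N : ℕ} (p : PMF (Action N)) : IsMarkovKernel (roundKernel p) := by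
  unfold roundKernel; infer_instance

/-- The law of `(A_t, O_{t+1})` under the agent `π`, given the parameters and `H_t`. -/
noncomputable def stepKernel {N : ℕ} (π : Agent N) (t : ℕ) :
    Kernel (Params N × Hist N t) (Action N × Bool) where
  toFun z := roundKernel (π t z.2) z.1
  measurable' :=
    measurable_from_prod_countable_left fun h => (roundKernel (π t h)).measurable

instance {N : ℕ} (π : Agent N) (t : ℕ) : IsMarkovKernel (stepKernel π t) where
  isProbabilityMeasure z :=
    inferInstanceAs (IsProbabilityMeasure (roundKernel (π t z.2) z.1))

/-- Append a pair (action, observation) to a history. -/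
def extend {N t : ℕ} (z : Hist N t × (Action N × Bool)) : Hist N (t + 1) :=
  Fin.snoc (α := fun _ => Action N × Bool) z.1 z.2

/-- The law of `H_t` under the agent `π`, given the parameters. -/
noncomputable def histKernel {N : ℕ} (π : Agent N) : ∀ t : ℕ, Kernel (Params N) (Hist N t)
  | 0 => Kernel.const (Params N) (Measure.dirac Fin.elim0)
  | t + 1 => (histKernel π t ⊗ₖ stepKernel π t).map extend

instance {N : ℕ} (π : Agent N) (t : ℕ) : IsMarkovKernel (histKernel π t) := by
  induction t with
  | zero => unfold histKernel; infer_instance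
  | succ t ih => unfold histKernel; exact Kernel.IsMarkovKernel.map _ (measurable_of_countable _)

/-- The joint law of `((θ, φ), H_t)` under the agent `π`. -/
noncomputable def histLaw {N : ℕ} (π : Agent N) (t : ℕ) : Measure (Params N × Hist N t) :=
  prior N ⊗ₘ histKernel π t

/-- The joint law of `(((θ, φ), H_t), (A_t, O_{t+1}))` under the agent `π`. -/
noncomputable def stepLaw {N : ℕ} (π : Agent N) (t : ℕ) :
    Measure ((Params N × Hist N t) × (Action N × Bool)) :=
  histLaw π t ⊗ₘ stepKernel π t

/-- The reward `ℛ(a, o, θ)`. -/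
noncomputable def reward {N : ℕ} (a : Action N) (o : Bool) (θ : Fin N → I) : ℝ :=
  match a with
  | Sum.inl a => if o then (θ a : ℝ) else 1 - (θ a : ℝ)
  | Sum.inr _ => -1

/-- The reward `R*` of the optimal action: `max_a E[ℛ(a, O, θ) | θ, φ, A = a]`. -/
noncomputable def optReward {N : ℕ} (x : Params N) : ℝ :=
  ⨆ a : Action N, ∫ o, reward a o x.1 ∂(obsKernel N (x, a))

/-- The regret `∑_{t < T} E_π[R* - R_{t+1}]`. -/
noncomputable def regret {N : ℕ} (π : Agent N) (T : ℕ) : ℝ :=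
  ∑ t ∈ Finset.range T, ∫ z, (optReward z.1.1 - reward z.2.1 z.2.2 z.1.1.1) ∂(stepLaw π t)

/-- The conditional law of `(θ, φ)` given the event `H_t = h`, under the agent `π`. -/
noncomputable def posterior {N : ℕ} (π : Agent N) (t : ℕ) (h : Hist N t) : Measure (Params N) :=
  (cond (histLaw π t) (Prod.snd ⁻¹' {h})).map Prod.fst

/-- The mutual information (in nats) of the two coordinates of a pair with joint law `μ`. -/
noncomputable def mutualInfo {X Y : Type*} [MeasurableSpace X] [MeasurableSpace Y]
    (μ : Measure (X × Y)) : ℝ≥0∞ :=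
  klDiv μ (μ.fst.prod μ.snd)

/-- The conditional law of `((θ, φ), (A_t, O_{t+1}))` given `H_t = h`, where `H_t` is generated by
the agent `π` and `A_t` is drawn from `p`. -/
noncomputable def condStepLaw {N : ℕ} (π : Agent N) (t : ℕ) (h : Hist N t) (p : PMF (Action N)) :
    Measure (Params N × (Action N × Bool)) :=
  posterior π t h ⊗ₘ roundKernel p

/-- The conditional information ratio at `H_t = h` of drawing `A_t` from `p`:
`E[R* - R_{t+1} | H_t = h]² / I(θ, φ; A_t, O_{t+1} | H_t = h)`. -/
noncomputable def infoRatio {N : ℕ} (π : Agent N) (t : ℕ) (h : Hist N t) (p : PMF (Action N)) :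
    ℝ≥0∞ :=
  ENNReal.ofReal
      ((∫ z, (optReward z.1 - reward z.2.1 z.2.2 z.1.1) ∂(condStepLaw π t h p)) ^ 2) /
    mutualInfo (condStepLaw π t h p)

/-- `π` is an information-directed sampling agent: at every history that occurs with positive
probability, its action distribution minimizes the conditional information ratio over all
probability mass functions on the actions. -/
def IsIDS {N : ℕ} (π : Agent N) : Prop :=
  ∀ (t : ℕ) (h : Hist N t), histLaw π t (Prod.snd ⁻¹' {h}) ≠ 0 →
    ∀ p : PMF (Action N), infoRatio π t h (π t h) ≤ infoRatio π t h p

end BanditAlignment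

/-! Since arms and human preferences are independent and uniform, the posterior after a history is a
product of beta laws determined by the success and failure counts; the agent's action probabilities
cancel (`posterior_eq_histPost`). The information in a round is then the average, over the action
drawn, of the expected Bernoulli divergence `obsInfo` (`mutualInfo_compProd_roundKernel`).

An IDS agent does at least as well, in information ratio, as any comparison law. The comparison law
draws an arm by Thompson sampling, pulls it with probability `1 - ε` and queries about it with
probability `ε` (`exists_sq_roundRegret_le`). Its regret has two parts. The Thompson part is
controlled by the posterior variances of both coordinates of the arm (`sq_thompson_regret_le`),
hence by the information through Pinsker's inequality. The query part is at most `2 * ε`, which does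
not shrink; but every action still yields at least `1 / (4 * (t + 3))` nats (`le_obsInfo`), so a
constant is at most a multiple of `t + 3` times the information.

An action tried `n` times yields at most `1 / (n + 3) ≤ log ((n + 3) / (n + 2))` nats, which
telescopes to a total of `|𝒜| * log ((T + 2) / 2)` (`sum_roundInfo_le`). Cauchy-Schwarz over rounds
and histories combines the two bounds, and `add_two_mul_log_le` trades the shift `T + 2` for the
constant `4` in the logarithm. -/

namespace BanditAlignment

/-! ### Bounds on the Bernoulli divergence. -/

section

/-- A Padé lower bound for the logarithm. -/
theorem log_ge_pade {x : ℝ} (hx : 0 < x) :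
    (5 * x ^ 2 - 4 * x - 1) / (2 * x ^ 2 + 4 * x) ≤ Real.log x := by
  set D : ℝ → ℝ := fun x => Real.log x - (5 * x ^ 2 - 4 * x - 1) / (2 * x ^ 2 + 4 * x) with hD
  -- The derivative changes sign only at `1`, where the difference vanishes, so `1` is its global
  -- minimum.
  have hder : ∀ y : ℝ, 0 < y → HasDerivAt D ((y - 1) ^ 3 / (y ^ 2 * (y + 2) ^ 2)) y := by
    intro y hy
    have h2 : HasDerivAt (fun x : ℝ => 5 * x ^ 2 - 4 * x - 1) (10 * y - 4) y := by
      have := (((hasDerivAt_pow 2 y).const_mul 5).sub ((hasDerivAt_id y).const_mul 4)).sub_const 1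
      refine this.congr_deriv ?_
      norm_num; ring
    have h3 : HasDerivAt (fun x : ℝ => 2 * x ^ 2 + 4 * x) (4 * y + 4) y := by
      have := ((hasDerivAt_pow 2 y).const_mul 2).add ((hasDerivAt_id y).const_mul 4)
      refine this.congr_deriv ?_
      norm_num; ring
    have hne : 2 * y ^ 2 + 4 * y ≠ 0 := by positivity
    refine ((Real.hasDerivAt_log hy.ne').sub (h2.div h3 hne)).congr_deriv ?_
    have : y + 2 ≠ 0 := by positivity
    field_simp
    ring
  have hD1 : D 1 = 0 := by norm_num [hD]
  have hcont : ∀ s : Set ℝ, (∀ y ∈ s, 0 < y) → ContinuousOn D s := fun s hs y hy =>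
    (hder y (hs y hy)).continuousAt.continuousWithinAt
  suffices 0 ≤ D x by simpa [hD] using this
  rcases le_total 1 x with h | h
  · have hm : MonotoneOn D (Set.Ici 1) := by
      refine monotoneOn_of_deriv_nonneg (convex_Ici 1) (hcont _ fun y hy => ?_) ?_ ?_
      · exact lt_of_lt_of_le one_pos hy
      · intro y hy
        rw [interior_Ici] at hy
        exact (hder y (one_pos.trans hy)).differentiableAt.differentiableWithinAt
      · intro y hy
        rw [interior_Ici] at hy
        have hy' : (1 : ℝ) < y := hy
        rw [(hder y (one_pos.trans hy)).deriv]
        have : 0 ≤ y - 1 := by linarith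
        positivity
    rw [← hD1]
    exact hm (Set.self_mem_Ici) h h
  · have hm : AntitoneOn D (Set.Ioc 0 1) := by
      refine antitoneOn_of_deriv_nonpos (convex_Ioc 0 1) (hcont _ fun y hy => hy.1) ?_ ?_
      · intro y hy
        rw [interior_Ioc] at hy
        exact (hder y hy.1).differentiableAt.differentiableWithinAt
      · intro y hy
        rw [interior_Ioc] at hy
        rw [(hder y hy.1).deriv]
        have h1 : (y - 1) ^ 3 ≤ 0 := Odd.pow_nonpos (by decide) (by linarith [hy.2])
        exact div_nonpos_of_nonpos_of_nonneg h1 (by positivity)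
    rw [← hD1]
    exact hm ⟨hx, h⟩ ⟨one_pos, le_rfl⟩ h

/-- The Padé bound multiplied by `x`. It agrees with `klFun` to third order at `1`, which keeps the
sharp constant in Pinsker's inequality. -/
theorem klFun_ge_rational {x : ℝ} (hx : 0 ≤ x) :
    3 * (x - 1) ^ 2 / (2 * (x + 2)) ≤ klFun x := by
  rcases hx.eq_or_lt with rfl | hx
  · norm_num [klFun_zero]
  · have h := mul_le_mul_of_nonneg_left (log_ge_pade hx) hx.le
    rw [klFun_apply]
    have : 3 * (x - 1) ^ 2 / (2 * (x + 2))
        = x * ((5 * x ^ 2 - 4 * x - 1) / (2 * x ^ 2 + 4 * x)) + 1 - x := by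
      have : x + 2 ≠ 0 := by positivity
      field_simp
      ring
    linarith

/-- Replaces the convex factor `3 / (2 * (x + 2))` of the rational bound by its tangent line at `x =
4`. A polynomial bound can be integrated with only the second and third central moments. -/
theorem klFun_ge_cubic {x : ℝ} (hx : 0 ≤ x) :
    3 / 8 * (x - 1) ^ 2 - 1 / 24 * (x - 1) ^ 3 ≤ klFun x := by
  refine le_trans ?_ (klFun_ge_rational hx)
  rw [le_div_iff₀ (by positivity)]
  nlinarith [mul_nonneg (sq_nonneg (x - 1)) (sq_nonneg (x - 4))]

/-- The Kullback-Leibler divergence of Bernoulli(`q`) from Bernoulli(`p`). -/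
noncomputable def klBer (p q : ℝ) : ℝ :=
  q * Real.log (q / p) + (1 - q) * Real.log ((1 - q) / (1 - p))

variable {p q : ℝ}

theorem klBer_eq_klFun (hp0 : 0 < p) (hp1 : p < 1) :
    klBer p q = p * klFun (q / p) + (1 - p) * klFun ((1 - q) / (1 - p)) := by
  have : 1 - p ≠ 0 := by linarith
  rw [klBer, klFun_apply, klFun_apply]
  field_simp
  ring

/-- Pinsker's inequality. The two denominators `u = q + 2 * p` and `v = (1 - q) + 2 * (1 - p)` sum
to `3`, so `u * v ≤ 9 / 4`. -/
theorem two_mul_sq_le_klBer (hp0 : 0 < p) (hp1 : p < 1) (hq0 : 0 ≤ q) (hq1 : q ≤ 1) :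
    2 * (q - p) ^ 2 ≤ klBer p q := by
  have hp1' : 0 < 1 - p := by linarith
  have hq1' : 0 ≤ 1 - q := by linarith
  have h1 := mul_le_mul_of_nonneg_left (klFun_ge_rational (div_nonneg hq0 hp0.le)) hp0.le
  have h2 := mul_le_mul_of_nonneg_left (klFun_ge_rational (div_nonneg hq1' hp1'.le)) hp1'.le
  rw [klBer_eq_klFun hp0 hp1]
  refine le_trans ?_ (add_le_add h1 h2)
  have e1 : p * (3 * (q / p - 1) ^ 2 / (2 * (q / p + 2))) = 3 * (q - p) ^ 2 / (2 * (q + 2 * p)) := by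
    have : q + 2 * p ≠ 0 := by positivity
    field_simp
  have e2 : (1 - p) * (3 * ((1 - q) / (1 - p) - 1) ^ 2 / (2 * ((1 - q) / (1 - p) + 2)))
      = 3 * (q - p) ^ 2 / (2 * ((1 - q) + 2 * (1 - p))) := by
    have : (1 - q) + 2 * (1 - p) ≠ 0 := by positivity
    field_simp
    ring
  rw [e1, e2]
  have a1 : 0 < q + 2 * p := by positivity
  have a2 : 0 < (1 - q) + 2 * (1 - p) := by positivity
  rw [div_add_div _ _ (by positivity) (by positivity), le_div_iff₀ (by positivity)]
  nlinarith [mul_nonneg (sq_nonneg (q - p)) (sq_nonneg (2 * (q + 2 * p) - 3))]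

theorem cubic_le_klBer (hp0 : 0 < p) (hp1 : p < 1) (hq0 : 0 ≤ q) (hq1 : q ≤ 1) :
    3 / 8 * (1 / p + 1 / (1 - p)) * (q - p) ^ 2
      - 1 / 24 * (1 / p ^ 2 - 1 / (1 - p) ^ 2) * (q - p) ^ 3 ≤ klBer p q := by
  have hp1' : 0 < 1 - p := by linarith
  have hq1' : 0 ≤ 1 - q := by linarith
  have h1 := mul_le_mul_of_nonneg_left (klFun_ge_cubic (div_nonneg hq0 hp0.le)) hp0.le
  have h2 := mul_le_mul_of_nonneg_left (klFun_ge_cubic (div_nonneg hq1' hp1'.le)) hp1'.le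
  rw [klBer_eq_klFun hp0 hp1]
  refine le_trans (le_of_eq ?_) (add_le_add h1 h2)
  field_simp
  ring

/-- The chi-square bound, from `log x ≤ x - 1`. -/
theorem klBer_le (hp0 : 0 < p) (hp1 : p < 1) (hq0 : 0 ≤ q) (hq1 : q ≤ 1) :
    klBer p q ≤ (q - p) ^ 2 / (p * (1 - p)) := by
  have hp1' : 0 < 1 - p := by linarith
  have key : ∀ {a b : ℝ}, 0 ≤ a → 0 < b → a * Real.log (a / b) ≤ a * (a / b - 1) := by
    intro a b ha hb
    rcases ha.eq_or_lt with rfl | ha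
    · simp
    · exact mul_le_mul_of_nonneg_left (Real.log_le_sub_one_of_pos (by positivity)) ha.le
  refine le_trans (add_le_add (key hq0 hp0) (key (by linarith : 0 ≤ 1 - q) hp1')) (le_of_eq ?_)
  field_simp
  ring

@[fun_prop]
theorem measurable_klBer (p : ℝ) : Measurable (klBer p) := by
  unfold klBer; fun_prop

theorem klBer_nonneg (hp0 : 0 < p) (hp1 : p < 1) (hq0 : 0 ≤ q) (hq1 : q ≤ 1) : 0 ≤ klBer p q :=
  le_trans (by positivity) (two_mul_sq_le_klBer hp0 hp1 hq0 hq1)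

end

/-! ### The uniform prior, the product-beta posterior and its moments. -/

section

theorem betaMeasure_one_one : betaMeasure 1 1 = volume.restrict (Set.Ioo 0 1) := by
  rw [betaMeasure, ← withDensity_indicator_one measurableSet_Ioo]
  congr 1
  ext x
  by_cases h : x ∈ Set.Ioo (0 : ℝ) 1
  · rw [betaPDF_of_pos_lt_one h.1 h.2, Set.indicator_of_mem h]
    simp [beta, one_add_one_eq_two]
  · rw [Set.indicator_of_notMem h, betaPDF_eq, if_neg (by simpa using h), ENNReal.ofReal_zero]

theorem integral_betaPrior (g : ℝ → ℝ) :
    ∫ y : I, g y ∂betaPrior = ∫ x in (0 : ℝ)..1, g x := by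
  rw [betaPrior, integral_subtype_comap measurableSet_Icc, betaMeasure_one_one,
    Measure.restrict_restrict measurableSet_Icc,
    Set.inter_eq_right.2 Set.Ioo_subset_Icc_self, ← integral_Ioc_eq_integral_Ioo,
    intervalIntegral.integral_of_le zero_le_one]

/-- The beta function at the point `(s + 1, f + 1)`, as an integral over the prior. -/
noncomputable def betaInt (s f : ℕ) : ℝ := ∫ y : I, (y : ℝ) ^ s * (1 - (y : ℝ)) ^ f ∂betaPrior

theorem betaInt_eq (s f : ℕ) : betaInt s f = ∫ x in (0 : ℝ)..1, x ^ s * (1 - x) ^ f :=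
  integral_betaPrior fun x => x ^ s * (1 - x) ^ f

theorem betaInt_pos (s f : ℕ) : 0 < betaInt s f := by
  rw [betaInt_eq]
  refine intervalIntegral.intervalIntegral_pos_of_pos_on
    (Continuous.intervalIntegrable (by fun_prop) _ _) (fun x hx => ?_) one_pos
  have := hx.1
  have : 0 < 1 - x := by linarith [hx.2]
  positivity

theorem betaInt_add (s f : ℕ) : betaInt (s + 1) f + betaInt s (f + 1) = betaInt s f := by
  simp only [betaInt_eq]
  rw [← intervalIntegral.integral_add (Continuous.intervalIntegrable (by fun_prop) _ _)
    (Continuous.intervalIntegrable (by fun_prop) _ _)]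
  congr 1
  ext x
  ring

/-- Integration by parts: `x ^ (s + 1) * (1 - x) ^ (f + 1)` vanishes at both endpoints. -/
theorem betaInt_parts (s f : ℕ) :
    (s + 1 : ℝ) * betaInt s (f + 1) = (f + 1 : ℝ) * betaInt (s + 1) f := by
  have h := intervalIntegral.integral_eq_sub_of_hasDerivAt (a := (0 : ℝ)) (b := 1)
    (f := fun x : ℝ => x ^ (s + 1) * (1 - x) ^ (f + 1))
    (f' := fun x => (s + 1) * (x ^ s * (1 - x) ^ (f + 1)) - (f + 1) * (x ^ (s + 1) * (1 - x) ^ f))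
    (fun x _ => by
      have h1 := hasDerivAt_pow (s + 1) x
      have h2 := ((hasDerivAt_id x).const_sub 1).pow (f + 1)
      refine (h1.mul h2).congr_deriv ?_
      simp
      ring)
    (Continuous.intervalIntegrable (by fun_prop) _ _)
  rw [intervalIntegral.integral_sub (Continuous.intervalIntegrable (by fun_prop) _ _)
    (Continuous.intervalIntegrable (by fun_prop) _ _), intervalIntegral.integral_const_mul,
    intervalIntegral.integral_const_mul, ← betaInt_eq, ← betaInt_eq] at h
  simp at h
  linarith

/-- The recurrence from which every posterior moment below is computed. -/
theorem betaInt_succ (s f : ℕ) :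
    betaInt (s + 1) f = (s + 1) / (s + f + 2) * betaInt s f := by
  have h1 := betaInt_add s f
  have h2 := betaInt_parts s f
  have : (s + f + 2 : ℝ) ≠ 0 := by positivity
  field_simp
  rw [← h1]
  linear_combination -h2

variable {N : ℕ}

@[fun_prop]
theorem measurable_successProb (a : Action N) : Measurable fun x : Params N => successProb x a := by
  cases a
  · exact (measurable_pi_apply _).comp measurable_snd
  · exact (measurable_pi_apply _).comp measurable_fst

/-- Indexing coordinates by actions lets pulls and queries be treated uniformly from here on. -/
theorem integral_prior_prod (g : Action N → I → ℝ) :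
    ∫ x, ∏ a, g a (successProb x a) ∂prior N = ∏ a, ∫ y, g a y ∂betaPrior := by
  simp only [Fintype.prod_sum_type, successProb, prior]
  rw [← integral_fintype_prod_eq_prod, ← integral_fintype_prod_eq_prod, mul_comm,
    ← integral_prod_mul]
  simp only [mul_comm]

/-- The likelihood of observing, for each action `a`, `s a` successes and `f a` failures. -/
noncomputable def likelihood (s f : Action N → ℕ) (x : Params N) : ℝ :=
  ∏ a, ((successProb x a : ℝ) ^ s a * (1 - (successProb x a : ℝ)) ^ f a)

variable (s f : Action N → ℕ)

@[fun_prop]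
theorem measurable_likelihood : Measurable (likelihood s f) := by
  unfold likelihood
  fun_prop

theorem likelihood_nonneg (x : Params N) : 0 ≤ likelihood s f x :=
  Finset.prod_nonneg fun a _ => mul_nonneg (pow_nonneg (successProb x a).2.1 _)
    (pow_nonneg (by linarith [(successProb x a).2.2]) _)

theorem likelihood_le_one (x : Params N) : likelihood s f x ≤ 1 := by
  refine Finset.prod_le_one (fun a _ => mul_nonneg (pow_nonneg (successProb x a).2.1 _)
    (pow_nonneg (by linarith [(successProb x a).2.2]) _)) fun a _ => ?_
  have h0 := (successProb x a).2.1
  have h1 := (successProb x a).2.2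
  exact mul_le_one₀ (pow_le_one₀ h0 h1) (pow_nonneg (by linarith) _)
    (pow_le_one₀ (by linarith) (by linarith))

/-- The marginal probability of the counts `s` and `f` (in a fixed order of the observations). -/
noncomputable def evidence : ℝ := ∏ a, betaInt (s a) (f a)

theorem evidence_pos : 0 < evidence s f := Finset.prod_pos fun _ _ => betaInt_pos _ _

theorem integral_likelihood : ∫ x, likelihood s f x ∂prior N = evidence s f :=
  integral_prior_prod fun a y => (y : ℝ) ^ s a * (1 - (y : ℝ)) ^ f a

/-- The posterior after `s a` successes and `f a` failures of each action `a`. -/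
noncomputable def betaPost : Measure (Params N) :=
  (prior N).withDensity fun x => ENNReal.ofReal (likelihood s f x / evidence s f)

theorem integral_betaPost (F : Params N → ℝ) :
    ∫ x, F x ∂betaPost s f = (∫ x, F x * likelihood s f x ∂prior N) / evidence s f := by
  rw [betaPost, integral_withDensity_eq_integral_toReal_smul (by fun_prop) (by simp),
    ← integral_div]
  congr 1
  ext x
  rw [ENNReal.toReal_ofReal (div_nonneg (likelihood_nonneg s f x) (evidence_pos s f).le),
    smul_eq_mul]
  ring

theorem integral_betaPost_prod (g : Action N → I → ℝ) :
    ∫ x, ∏ a, g a (successProb x a) ∂betaPost s f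
      = ∏ a, (∫ y : I, g a y * ((y : ℝ) ^ s a * (1 - (y : ℝ)) ^ f a) ∂betaPrior)
          / betaInt (s a) (f a) := by
  rw [integral_betaPost, Finset.prod_div_distrib, ← integral_prior_prod, evidence]
  simp only [likelihood, Finset.prod_mul_distrib]

theorem integrable_likelihood : Integrable (likelihood s f) (prior N) :=
  Integrable.of_bound (by fun_prop) 1 (ae_of_all _ fun x => by
    rw [Real.norm_of_nonneg (likelihood_nonneg s f x)]
    exact likelihood_le_one s f x)

instance : IsProbabilityMeasure (betaPost s f) where
  measure_univ := by
    rw [betaPost, withDensity_apply _ MeasurableSet.univ, Measure.restrict_univ,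
      ← ofReal_integral_eq_lintegral_ofReal, integral_div, integral_likelihood,
      div_self (evidence_pos s f).ne', ENNReal.ofReal_one]
    · exact (integrable_likelihood s f).div_const _
    · exact ae_of_all _ fun x => div_nonneg (likelihood_nonneg s f x) (evidence_pos s f).le

/-- The expectation of a function of one coordinate under the posterior. -/
theorem integral_betaPost_coord (a : Action N) (g : I → ℝ) :
    ∫ x, g (successProb x a) ∂betaPost s f
      = (∫ y : I, g y * ((y : ℝ) ^ s a * (1 - (y : ℝ)) ^ f a) ∂betaPrior)
          / betaInt (s a) (f a) := by
  have h := integral_betaPost_prod s f (Function.update (fun _ _ => 1) a g)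
  rw [Finset.prod_eq_single a, Function.update_self] at h
  · rw [← h]
    congr 1
    ext x
    rw [Finset.prod_eq_single a, Function.update_self]
    · intro b _ hb
      rw [Function.update_of_ne hb]
    · simp
  · intro b _ hb
    rw [Function.update_of_ne hb]
    simp only [one_mul]
    exact div_self (betaInt_pos _ _).ne'
  · simp

/-- Distinct coordinates are independent under the posterior. -/
theorem integral_betaPost_mul {a b : Action N} (hab : a ≠ b) (g k : I → ℝ) :
    ∫ x, g (successProb x a) * k (successProb x b) ∂betaPost s f
      = (∫ x, g (successProb x a) ∂betaPost s f) * ∫ x, k (successProb x b) ∂betaPost s f := by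
  have h := integral_betaPost_prod s f
    (Function.update (Function.update (fun _ _ => 1) a g) b k)
  rw [Finset.prod_eq_mul a b hab, Function.update_self, Function.update_of_ne hab,
    Function.update_self, ← integral_betaPost_coord, ← integral_betaPost_coord] at h
  · rw [← h]
    congr 1
    ext x
    rw [Finset.prod_eq_mul a b hab, Function.update_self, Function.update_of_ne hab,
      Function.update_self]
    · intro c _ hc
      rw [Function.update_of_ne hc.2, Function.update_of_ne hc.1]
    · simp
    · simp
  · intro c _ hc
    rw [Function.update_of_ne hc.2, Function.update_of_ne hc.1]
    simp only [one_mul]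
    exact div_self (betaInt_pos _ _).ne'
  · simp
  · simp

/-- The posterior mean of a coordinate. -/
noncomputable def postMean (a : Action N) : ℝ := (s a + 1) / (s a + f a + 2)

theorem postMean_pos (a : Action N) : 0 < postMean s f a := by
  unfold postMean; positivity

theorem postMean_lt_one (a : Action N) : postMean s f a < 1 := by
  unfold postMean
  rw [div_lt_one (by positivity)]
  linarith [(Nat.cast_nonneg (f a) : (0 : ℝ) ≤ f a)]

theorem integral_betaPost_pow (a : Action N) (k : ℕ) :
    ∫ x, (successProb x a : ℝ) ^ k ∂betaPost s f = betaInt (s a + k) (f a) / betaInt (s a) (f a) := by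
  rw [integral_betaPost_coord s f a (fun y => (y : ℝ) ^ k), betaInt]
  congr 3
  ext y
  ring

theorem integral_betaPost_successProb (a : Action N) :
    ∫ x, (successProb x a : ℝ) ∂betaPost s f = postMean s f a := by
  have h := integral_betaPost_pow s f a 1
  simp only [pow_one] at h
  rw [h, betaInt_succ, mul_div_assoc, div_self (betaInt_pos _ _).ne', mul_one, postMean]

theorem integrable_of_bounded {X : Type*} [MeasurableSpace X] {μ : Measure X} [IsFiniteMeasure μ]
    {F : X → ℝ} (hF : Measurable F) {c : ℝ} (h : ∀ x, |F x| ≤ c) : Integrable F μ :=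
  Integrable.of_bound hF.aestronglyMeasurable c (ae_of_all _ h)

theorem integrable_successProb_pow (a : Action N) (k : ℕ) {μ : Measure (Params N)}
    [IsFiniteMeasure μ] : Integrable (fun x => (successProb x a : ℝ) ^ k) μ :=
  integrable_of_bounded (by fun_prop) (c := 1) fun x => by
    rw [abs_of_nonneg (pow_nonneg (successProb x a).2.1 _)]
    exact pow_le_one₀ (successProb x a).2.1 (successProb x a).2.2

theorem integral_betaPost_variance (a : Action N) :
    ∫ x, ((successProb x a : ℝ) - postMean s f a) ^ 2 ∂betaPost s f
      = postMean s f a * (1 - postMean s f a) / (s a + f a + 3) := by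
  have i1 := integrable_successProb_pow a 1 (μ := betaPost s f)
  have i2 := integrable_successProb_pow a 2 (μ := betaPost s f)
  have e1 := integral_betaPost_pow s f a 1
  have e2 := integral_betaPost_pow s f a 2
  have : ∀ x : Params N, ((successProb x a : ℝ) - postMean s f a) ^ 2
      = (successProb x a : ℝ) ^ 2 - 2 * postMean s f a * (successProb x a : ℝ) ^ 1
        + postMean s f a ^ 2 := fun x => by ring
  simp only [this]
  have j1 : Integrable (fun x : Params N => (successProb x a : ℝ) ^ 2
      - 2 * postMean s f a * (successProb x a : ℝ) ^ 1) (betaPost s f) := i2.sub (i1.const_mul _)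
  rw [integral_add j1 (integrable_const _), integral_sub i2 (i1.const_mul _), integral_const_mul, e1, e2, betaInt_succ, betaInt_succ]
  have := (betaInt_pos (s a) (f a)).ne'
  simp only [postMean, integral_const, probReal_univ, smul_eq_mul, one_mul]
  push_cast
  field_simp
  ring

theorem integral_betaPost_third (a : Action N) :
    ∫ x, ((successProb x a : ℝ) - postMean s f a) ^ 3 ∂betaPost s f
      = 2 * postMean s f a * (1 - postMean s f a) * (1 - 2 * postMean s f a)
        / ((s a + f a + 3) * (s a + f a + 4)) := by
  have i1 := integrable_successProb_pow a 1 (μ := betaPost s f)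
  have i2 := integrable_successProb_pow a 2 (μ := betaPost s f)
  have i3 := integrable_successProb_pow a 3 (μ := betaPost s f)
  have e1 := integral_betaPost_pow s f a 1
  have e2 := integral_betaPost_pow s f a 2
  have e3 := integral_betaPost_pow s f a 3
  have : ∀ x : Params N, ((successProb x a : ℝ) - postMean s f a) ^ 3
      = (successProb x a : ℝ) ^ 3 - 3 * postMean s f a * (successProb x a : ℝ) ^ 2
        + 3 * postMean s f a ^ 2 * (successProb x a : ℝ) ^ 1 - postMean s f a ^ 3 :=
    fun x => by ring
  simp only [this]
  have j1 : Integrable (fun x : Params N => (successProb x a : ℝ) ^ 3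
      - 3 * postMean s f a * (successProb x a : ℝ) ^ 2) (betaPost s f) := i3.sub (i2.const_mul _)
  have j2 : Integrable (fun x : Params N => (successProb x a : ℝ) ^ 3
      - 3 * postMean s f a * (successProb x a : ℝ) ^ 2
      + 3 * postMean s f a ^ 2 * (successProb x a : ℝ) ^ 1) (betaPost s f) :=
    j1.add (i1.const_mul _)
  rw [integral_sub j2 (integrable_const _), integral_add j1 (i1.const_mul _),
    integral_sub i3 (i2.const_mul _), integral_const_mul, integral_const_mul, e1, e2, e3,
    betaInt_succ, betaInt_succ, betaInt_succ]
  have := (betaInt_pos (s a) (f a)).ne'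
  simp only [postMean, integral_const, probReal_univ, smul_eq_mul, one_mul]
  push_cast
  field_simp
  ring

theorem integrable_klBer (a : Action N) {m : ℝ} (hm0 : 0 < m) (hm1 : m < 1)
    {μ : Measure (Params N)} [IsFiniteMeasure μ] :
    Integrable (fun x => klBer m (successProb x a)) μ := by
  refine integrable_of_bounded (by fun_prop) (c := 1 / (m * (1 - m))) fun x => ?_
  have h0 := (successProb x a).2.1
  have h1 := (successProb x a).2.2
  have : 0 < 1 - m := by linarith
  rw [abs_of_nonneg (klBer_nonneg hm0 hm1 h0 h1)]
  refine (klBer_le hm0 hm1 h0 h1).trans ?_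
  gcongr
  rw [sq_le_one_iff_abs_le_one, abs_le]
  constructor <;> linarith

/-! ### Two-sided bounds on the information in one observation. -/

/-- The information, in nats, that the observation following `a` carries on the parameters. -/
noncomputable def obsInfo (a : Action N) : ℝ :=
  ∫ x, klBer (postMean s f a) (successProb x a) ∂betaPost s f

theorem integrable_sub_pow (a : Action N) (m : ℝ) (k : ℕ) {μ : Measure (Params N)}
    [IsFiniteMeasure μ] : Integrable (fun x => ((successProb x a : ℝ) - m) ^ k) μ :=
  integrable_of_bounded (by fun_prop) (c := (1 + |m|) ^ k) fun x => by
    rw [abs_pow]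
    gcongr
    refine (abs_sub _ _).trans ?_
    rw [abs_of_nonneg (successProb x a).2.1]
    gcongr
    exact (successProb x a).2.2

theorem two_mul_variance_le_obsInfo (a : Action N) :
    2 * ∫ x, ((successProb x a : ℝ) - postMean s f a) ^ 2 ∂betaPost s f ≤ obsInfo s f a := by
  rw [← integral_const_mul]
  exact integral_mono ((integrable_sub_pow a _ 2).const_mul _)
    (integrable_klBer a (postMean_pos s f a) (postMean_lt_one s f a)) fun x =>
      two_mul_sq_le_klBer (postMean_pos s f a) (postMean_lt_one s f a)
        (successProb x a).2.1 (successProb x a).2.2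

/-- In the chi-square bound the factor `m * (1 - m)` cancels against the beta variance, leaving a
bound free of the mean. -/
theorem obsInfo_le (a : Action N) : obsInfo s f a ≤ 1 / (s a + f a + 3) := by
  have hm0 := postMean_pos s f a
  have hm1 : 0 < 1 - postMean s f a := by linarith [postMean_lt_one s f a]
  have h : obsInfo s f a ≤ ∫ x, ((successProb x a : ℝ) - postMean s f a) ^ 2
      / (postMean s f a * (1 - postMean s f a)) ∂betaPost s f :=
    integral_mono (integrable_klBer a (postMean_pos s f a) (postMean_lt_one s f a))
      ((integrable_sub_pow a _ 2).div_const _) fun x =>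
      klBer_le (postMean_pos s f a) (postMean_lt_one s f a)
        (successProb x a).2.1 (successProb x a).2.2
  refine h.trans (le_of_eq ?_)
  rw [integral_div, integral_betaPost_variance]
  field_simp

/-- Pinsker alone would give `2 * m * (1 - m) / (s + f + 3)`, which degenerates for means near `0`
or `1`. The weights `1 / p` and `1 / (1 - p)` in the cubic bound remove this factor, and the
skewness correction is small enough to leave a uniform constant. -/
theorem le_obsInfo (a : Action N) : 1 / (4 * (s a + f a + 3)) ≤ obsInfo s f a := by
  set m := postMean s f a with hm
  have hm0 : 0 < m := postMean_pos s f a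
  have hm1 : 0 < 1 - m := by linarith [postMean_lt_one s f a]
  have h : ∫ x, (3 / 8 * (1 / m + 1 / (1 - m)) * ((successProb x a : ℝ) - m) ^ 2
      - 1 / 24 * (1 / m ^ 2 - 1 / (1 - m) ^ 2) * ((successProb x a : ℝ) - m) ^ 3) ∂betaPost s f
      ≤ obsInfo s f a :=
    integral_mono (((integrable_sub_pow a _ 2).const_mul _).sub
        ((integrable_sub_pow a _ 3).const_mul _))
      (integrable_klBer a (postMean_pos s f a) (postMean_lt_one s f a)) fun x =>
      cubic_le_klBer (postMean_pos s f a) (postMean_lt_one s f a)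
        (successProb x a).2.1 (successProb x a).2.2
  refine le_trans ?_ h
  rw [integral_sub ((integrable_sub_pow a _ 2).const_mul _)
    ((integrable_sub_pow a _ 3).const_mul _), integral_const_mul, integral_const_mul,
    integral_betaPost_variance, integral_betaPost_third, ← hm]
  have hs : (0 : ℝ) ≤ s a := Nat.cast_nonneg _
  have hf : (0 : ℝ) ≤ f a := Nat.cast_nonneg _
  have e : 3 / 8 * (1 / m + 1 / (1 - m)) * (m * (1 - m) / (s a + f a + 3))
      - 1 / 24 * (1 / m ^ 2 - 1 / (1 - m) ^ 2)
        * (2 * m * (1 - m) * (1 - 2 * m) / ((s a + f a + 3) * (s a + f a + 4)))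
      = 1 / (s a + f a + 3) * (3 / 8 - 1 / 12 * ((1 - 2 * m) ^ 2 / (m * (1 - m)))
        / (s a + f a + 4)) := by
    field_simp
    ring
  rw [e, ← div_div, div_eq_mul_one_div (1 / 4 : ℝ), mul_comm]
  refine mul_le_mul_of_nonneg_left ?_ (by positivity)
  have k : (1 - 2 * m) ^ 2 / (m * (1 - m)) = (f a - s a) ^ 2 / ((s a + 1) * (f a + 1)) := by
    have : (1 : ℝ) - m = (f a + 1) / (s a + f a + 2) := by
      rw [hm, postMean]; field_simp; ring
    have h2 : 1 - 2 * m = (f a - s a) / (s a + f a + 2) := by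
      rw [hm, postMean]; field_simp; ring
    rw [this, h2, hm, postMean]
    field_simp
  -- This caps the skewness correction at `1 / 12`, and `3 / 8 - 1 / 12 = 7 / 24 ≥ 1 / 4`.
  have k2 : ((f a : ℝ) - s a) ^ 2 / ((s a + 1) * (f a + 1)) ≤ s a + f a + 4 := by
    rw [div_le_iff₀ (by positivity)]
    nlinarith [mul_nonneg hs hf, mul_nonneg hs (mul_nonneg hs hf), mul_nonneg hf (mul_nonneg hs hf)]
  rw [k, mul_div_assoc]
  have k3 : ((f a : ℝ) - s a) ^ 2 / ((s a + 1) * (f a + 1)) / (s a + f a + 4) ≤ 1 := by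
    rw [div_le_one (by positivity)]
    exact k2
  linarith

end

/-! ### The mutual information of a round. -/

section

/-- The probability of the observation `o` when `1` has the probability `r`. -/
def obsProb (r : ℝ) (o : Bool) : ℝ := if o then r else 1 - r

@[simp] theorem obsProb_true (r : ℝ) : obsProb r true = r := rfl

@[simp] theorem obsProb_false (r : ℝ) : obsProb r false = 1 - r := rfl

theorem obsProb_nonneg {r : ℝ} (h0 : 0 ≤ r) (h1 : r ≤ 1) (o : Bool) : 0 ≤ obsProb r o := by
  cases o
  · simpa using h1
  · simpa using h0

theorem obsProb_pos {r : ℝ} (h0 : 0 < r) (h1 : r < 1) (o : Bool) : 0 < obsProb r o := by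
  cases o
  · simpa using h1
  · simpa using h0

@[fun_prop]
theorem measurable_obsProb (o : Bool) : Measurable fun r => obsProb r o := by
  cases o
  · simp only [obsProb_false]; fun_prop
  · simp only [obsProb_true]; fun_prop

variable {N : ℕ}

theorem obsKernel_singleton (x : Params N) (a : Action N) (o : Bool) :
    obsKernel N (x, a) {o} = ENNReal.ofReal (obsProb (successProb x a) o) := by
  change bernoulliMeasure true false (successProb x a) {o} = _
  classical
  rw [bernoulliMeasure_apply _ (measurableSet_singleton o)]
  cases o
  · simp [ENNReal.ofReal, obsProb]
    rw [← NNReal.coe_inj, Real.coe_toNNReal _ (by linarith [(successProb x a).2.2])]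
    rfl
  · simp [ENNReal.ofReal, obsProb]
    rw [← NNReal.coe_inj, Real.coe_toNNReal _ (successProb x a).2.1]
    rfl

theorem roundKernel_singleton (p : PMF (Action N)) (x : Params N) (b : Action N × Bool) :
    roundKernel p x {b} = p b.1 * ENNReal.ofReal (obsProb (successProb x b.1) b.2) := by
  classical
  obtain ⟨a, o⟩ := b
  rw [roundKernel, ← Set.singleton_prod_singleton,
    Kernel.compProd_apply_prod (measurableSet_singleton a) (measurableSet_singleton o),
    Kernel.const_apply, lintegral_singleton, obsKernel_singleton,
    PMF.toMeasure_apply_singleton _ _ (measurableSet_singleton a), mul_comm]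

theorem lintegral_ofReal_obsProb (μ : Measure (Params N)) [IsProbabilityMeasure μ] (a : Action N)
    (o : Bool) : ∫⁻ x, ENNReal.ofReal (obsProb (successProb x a) o) ∂μ
      = ENNReal.ofReal (obsProb (∫ x, (successProb x a : ℝ) ∂μ) o) := by
  have hi : Integrable (fun x : Params N => (successProb x a : ℝ)) μ := by
    simpa using integrable_successProb_pow a 1 (μ := μ)
  rw [← ofReal_integral_eq_lintegral_ofReal]
  · cases o
    · simp only [obsProb_false]
      rw [integral_sub (integrable_const _) hi]
      simp
    · simp
  · cases o
    · exact (integrable_const _).sub hi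
    · exact hi
  · exact ae_of_all _ fun x => obsProb_nonneg (successProb x a).2.1 (successProb x a).2.2 o

theorem klBer_eq_sum {m r : ℝ} (hm0 : 0 < m) (hm1 : m < 1) :
    klBer m r = ∑ o, obsProb m o * klFun (obsProb r o / obsProb m o) := by
  rw [klBer_eq_klFun hm0 hm1]
  simp

/-- The information that a round carries on the parameters is the average over the actions of the
information that the observation carries. -/
theorem mutualInfo_compProd_roundKernel (μ : Measure (Params N)) [IsProbabilityMeasure μ]
    (p : PMF (Action N)) (m : Action N → ℝ) (hm : ∀ a, ∫ x, (successProb x a : ℝ) ∂μ = m a)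
    (hm0 : ∀ a, 0 < m a) (hm1 : ∀ a, m a < 1) :
    mutualInfo (μ ⊗ₘ roundKernel p)
      = ∑ a, p a * ENNReal.ofReal (∫ x, klBer (m a) (successProb x a) ∂μ) := by
  set ν : Measure (Action N × Bool) := (μ ⊗ₘ roundKernel p).snd with hν
  have hνs : ∀ b, ν {b} = p b.1 * ENNReal.ofReal (obsProb (m b.1) b.2) := by
    intro b
    rw [hν, Measure.snd_apply (measurableSet_singleton b),
      Measure.compProd_apply (measurable_snd (measurableSet_singleton b))]
    have : ∀ x : Params N, roundKernel p x (Prod.mk x ⁻¹' (Prod.snd ⁻¹' {b}))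
        = p b.1 * ENNReal.ofReal (obsProb (successProb x b.1) b.2) := fun x =>
      roundKernel_singleton p x b
    simp only [this]
    rw [lintegral_const_mul _ (by fun_prop), lintegral_ofReal_obsProb, hm]
  -- The density of the joint law against the product of its marginals. The factor `p b.1` appears
  -- on both sides, so actions of probability zero need no separate treatment.
  set g : Params N → Action N × Bool → ℝ≥0∞ := fun x b =>
    ENNReal.ofReal (obsProb (successProb x b.1) b.2 / obsProb (m b.1) b.2) with hg
  have hgm : Measurable (Function.uncurry g) := by
    refine measurable_from_prod_countable_left fun b => ?_
    simp only [Function.uncurry_apply_pair, hg]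
    fun_prop
  have hker : roundKernel p = (Kernel.const (Params N) ν).withDensity g := by
    ext1 x
    refine Measure.ext_of_singleton fun b => ?_
    rw [Kernel.withDensity_apply _ hgm, withDensity_apply _ (measurableSet_singleton b),
      Kernel.const_apply, lintegral_singleton, roundKernel_singleton, hνs, hg]
    rw [mul_left_comm, ← ENNReal.ofReal_mul
      (div_nonneg (obsProb_nonneg (successProb x b.1).2.1 (successProb x b.1).2.2 _)
        (obsProb_pos (hm0 _) (hm1 _) _).le), div_mul_cancel₀ _ (obsProb_pos (hm0 _) (hm1 _) _).ne']
  have hJ : μ ⊗ₘ roundKernel p = (μ.prod ν).withDensity (Function.uncurry g) := by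
    have : IsSFiniteKernel ((Kernel.const (Params N) ν).withDensity g) := hker ▸ inferInstance
    conv_lhs => rw [hker]
    rw [Measure.compProd_withDensity hgm, Measure.compProd_const]
    rfl
  rw [mutualInfo, Measure.fst_compProd, ← hν,
    klDiv_eq_lintegral_klFun_of_ac (hJ ▸ withDensity_absolutelyContinuous _ _)]
  have hrn : (μ ⊗ₘ roundKernel p).rnDeriv (μ.prod ν) =ᵐ[μ.prod ν] Function.uncurry g := by
    rw [hJ]; exact Measure.rnDeriv_withDensity _ hgm
  rw [lintegral_congr_ae (g := fun z => ENNReal.ofReal (klFun (Function.uncurry g z).toReal))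
    (hrn.mono fun z hz => by simp only [hz]), lintegral_prod _ (by fun_prop)]
  have hinner : ∀ x : Params N, ∫⁻ b, ENNReal.ofReal (klFun (Function.uncurry g (x, b)).toReal) ∂ν
      = ∑ a, p a * ENNReal.ofReal (klBer (m a) (successProb x a)) := by
    intro x
    rw [lintegral_fintype, Fintype.sum_prod_type]
    refine Finset.sum_congr rfl fun a _ => ?_
    have hq : ∀ o, 0 ≤ obsProb (successProb x a) o / obsProb (m a) o := fun o =>
      div_nonneg (obsProb_nonneg (successProb x a).2.1 (successProb x a).2.2 _)
        (obsProb_pos (hm0 _) (hm1 _) _).le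
    rw [klBer_eq_sum (hm0 a) (hm1 a), ENNReal.ofReal_sum_of_nonneg fun o _ =>
      mul_nonneg (obsProb_pos (hm0 _) (hm1 _) _).le (klFun_nonneg (hq o)), Finset.mul_sum]
    refine Finset.sum_congr rfl fun o _ => ?_
    simp only [Function.uncurry_apply_pair, hg, hνs]
    rw [ENNReal.toReal_ofReal (hq o), ENNReal.ofReal_mul (obsProb_pos (hm0 _) (hm1 _) _).le]
    ring
  simp only [hinner]
  rw [lintegral_finsetSum _ fun a _ => by fun_prop]
  refine Finset.sum_congr rfl fun a _ => ?_
  rw [lintegral_const_mul _ (by fun_prop), ofReal_integral_eq_lintegral_ofReal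
    (integrable_klBer a (hm0 a) (hm1 a))]
  exact ae_of_all _ fun x => klBer_nonneg (hm0 a) (hm1 a) (successProb x a).2.1
    (successProb x a).2.2

end

/-! ### Histories, their probabilities and the posterior. -/

section

variable {N t : ℕ}

/-- The number of successes of the action `a` in the history `h`. -/
def succCount (h : Hist N t) (a : Action N) : ℕ := (Finset.univ.filter fun i => h i = (a, true)).card

/-- The number of failures of the action `a` in the history `h`. -/
def failCount (h : Hist N t) (a : Action N) : ℕ :=
  (Finset.univ.filter fun i => h i = (a, false)).card

theorem succCount_extend (h : Hist N t) (b : Action N × Bool) (a : Action N) :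
    succCount (extend (h, b)) a = succCount h a + if b = (a, true) then 1 else 0 := by
  rw [succCount, succCount, Finset.card_filter, Finset.card_filter, Fin.sum_univ_castSucc]
  simp only [extend, Fin.snoc_castSucc, Fin.snoc_last]

theorem failCount_extend (h : Hist N t) (b : Action N × Bool) (a : Action N) :
    failCount (extend (h, b)) a = failCount h a + if b = (a, false) then 1 else 0 := by
  rw [failCount, failCount, Finset.card_filter, Finset.card_filter, Fin.sum_univ_castSucc]
  simp only [extend, Fin.snoc_castSucc, Fin.snoc_last]

theorem succCount_add_failCount_le (h : Hist N t) (a : Action N) :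
    succCount h a + failCount h a ≤ t := by
  rw [succCount, failCount, ← Finset.card_union_of_disjoint]
  · exact (Finset.card_le_univ _).trans (by simp)
  · refine Finset.disjoint_filter.2 fun i _ h1 h2 => ?_
    simp [h1] at h2

/-- The likelihood of the observations in a history, given the parameters and the actions. -/
noncomputable def histLik (h : Hist N t) : Params N → ℝ := likelihood (succCount h) (failCount h)

theorem histLik_nonneg (h : Hist N t) (x : Params N) : 0 ≤ histLik h x := likelihood_nonneg _ _ x

theorem histLik_extend (h : Hist N t) (b : Action N × Bool) (x : Params N) :
    histLik (extend (h, b)) x = histLik h x * obsProb (successProb x b.1) b.2 := by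
  obtain ⟨a, o⟩ := b
  have key : ∀ c : Action N, (successProb x c : ℝ) ^ (if (a, o) = (c, true) then 1 else 0)
      * (1 - (successProb x c : ℝ)) ^ (if (a, o) = (c, false) then 1 else 0)
      = if c = a then obsProb (successProb x c) o else 1 := by
    intro c
    by_cases hc : c = a
    · subst hc; cases o <;> simp
    · have : a ≠ c := fun h => hc h.symm
      simp [hc, this]
  simp only [histLik, likelihood, succCount_extend, failCount_extend, pow_add]
  have : obsProb (successProb x a) o
      = ∏ c, if c = a then obsProb (successProb x c) o else 1 := by simp
  rw [this, ← Finset.prod_mul_distrib]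
  refine Finset.prod_congr rfl fun c _ => ?_
  rw [← key]
  ring

/-- The marginal probability of the observations in a history, given the actions. -/
noncomputable def histEvidence (h : Hist N t) : ℝ := evidence (succCount h) (failCount h)

theorem sum_histEvidence_extend (h : Hist N t) (a : Action N) :
    ∑ o, histEvidence (extend (h, (a, o))) = histEvidence h := by
  simp only [histEvidence, ← integral_likelihood]
  rw [← integral_finsetSum _ fun o _ => integrable_likelihood _ _]
  congr 1
  ext x
  have := fun o => histLik_extend h (a, o) x
  simp only [histLik] at this
  simp only [this, Fintype.sum_bool, obsProb_true, obsProb_false]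
  ring

/-- The product of the probabilities that the agent assigns to the actions of a history. -/
noncomputable def policyProb (π : Agent N) : ∀ t : ℕ, Hist N t → ℝ≥0∞
  | 0, _ => 1
  | t + 1, h => policyProb π t (Fin.init h) * π t (Fin.init h) (h (Fin.last t)).1

theorem policyProb_extend (π : Agent N) (h : Hist N t) (b : Action N × Bool) :
    policyProb π (t + 1) (extend (h, b)) = policyProb π t h * π t h b.1 := by
  rw [policyProb]
  simp [extend]

theorem policyProb_ne_top (π : Agent N) : ∀ (t : ℕ) (h : Hist N t), policyProb π t h ≠ ∞
  | 0, _ => by simp [policyProb]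
  | t + 1, h => by
    rw [policyProb]
    exact ENNReal.mul_ne_top (policyProb_ne_top π t _) (PMF.apply_ne_top _ _)

theorem extend_bijective : Function.Bijective (extend : Hist N t × (Action N × Bool) → _) := by
  refine Function.bijective_iff_has_inverse.2 ⟨fun h => (Fin.init h, h (Fin.last t)), ?_, ?_⟩
  · intro z
    simp [extend]
  · intro h
    simp [extend]

theorem extend_init_last (h : Hist N (t + 1)) : extend (Fin.init h, h (Fin.last t)) = h := by
  simp [extend]

/-- The agent's choices depend on the parameters only through the history, so its factor is free of
`x`; this is why the posterior depends on the counts alone. -/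
theorem histKernel_singleton (π : Agent N) (x : Params N) : ∀ (t : ℕ) (h : Hist N t),
    histKernel π t x {h} = policyProb π t h * ENNReal.ofReal (histLik h x)
  | 0, h => by
    have : h = Fin.elim0 := Subsingleton.elim _ _
    subst this
    simp [histKernel, policyProb, histLik, likelihood, succCount, failCount]
  | t + 1, h => by
    have hpre : (extend ⁻¹' {h} : Set (Hist N t × (Action N × Bool)))
        = {Fin.init h} ×ˢ {h (Fin.last t)} := by
      ext z
      rw [Set.singleton_prod_singleton, Set.mem_preimage, Set.mem_singleton_iff,
        Set.mem_singleton_iff, ← extend_bijective.injective.eq_iff, extend_init_last]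
    rw [histKernel, Kernel.map_apply' _ (measurable_of_countable _) _ (measurableSet_singleton h),
      hpre, Kernel.compProd_apply_prod (measurableSet_singleton _) (measurableSet_singleton _),
      lintegral_singleton, histKernel_singleton π x t, policyProb]
    have hs : stepKernel π t (x, Fin.init h) {h (Fin.last t)}
        = π t (Fin.init h) (h (Fin.last t)).1
          * ENNReal.ofReal (obsProb (successProb x (h (Fin.last t)).1) (h (Fin.last t)).2) :=
      roundKernel_singleton _ x _
    have hl := histLik_extend (Fin.init h) (h (Fin.last t)) x
    rw [extend_init_last] at hl
    rw [hs, hl, ENNReal.ofReal_mul (histLik_nonneg _ x)]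
    ring

theorem histLaw_prod_singleton (π : Agent N) (h : Hist N t) {s : Set (Params N)}
    (hs : MeasurableSet s) :
    histLaw π t (Prod.snd ⁻¹' {h} ∩ Prod.fst ⁻¹' s)
      = policyProb π t h * ∫⁻ x in s, ENNReal.ofReal (histLik h x) ∂prior N := by
  have : (Prod.snd ⁻¹' {h} ∩ Prod.fst ⁻¹' s : Set (Params N × Hist N t)) = s ×ˢ {h} := by
    ext z; simp [and_comm]
  have hm : Measurable fun x => ENNReal.ofReal (histLik h x) :=
    (measurable_likelihood _ _).ennreal_ofReal
  rw [this, histLaw, Measure.compProd_apply_prod hs (measurableSet_singleton h)]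
  simp only [histKernel_singleton]
  rw [lintegral_const_mul _ hm]

theorem lintegral_histLik (h : Hist N t) :
    ∫⁻ x, ENNReal.ofReal (histLik h x) ∂prior N = ENNReal.ofReal (histEvidence h) := by
  rw [histEvidence, ← integral_likelihood, ofReal_integral_eq_lintegral_ofReal
    (integrable_likelihood _ _) (ae_of_all _ (likelihood_nonneg _ _))]
  rfl

theorem histLaw_singleton (π : Agent N) (h : Hist N t) :
    histLaw π t (Prod.snd ⁻¹' {h}) = policyProb π t h * ENNReal.ofReal (histEvidence h) := by
  have := histLaw_prod_singleton π h MeasurableSet.univ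
  rwa [Set.preimage_univ, Set.inter_univ, Measure.restrict_univ, lintegral_histLik] at this

/-- The posterior after a history, which is a product of beta distributions. -/
noncomputable abbrev histPost (h : Hist N t) : Measure (Params N) :=
  betaPost (succCount h) (failCount h)

/-- Bayes' rule: positive probability of the history is what allows `policyProb` to be cancelled. -/
theorem posterior_eq_histPost (π : Agent N) (h : Hist N t)
    (hh : histLaw π t (Prod.snd ⁻¹' {h}) ≠ 0) : posterior π t h = histPost h := by
  ext s hs
  have hp : policyProb π t h ≠ 0 := by
    intro h0
    rw [histLaw_singleton, h0, zero_mul] at hh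
    exact hh rfl
  have hm : Measurable fun x => ENNReal.ofReal (histLik h x) :=
    (measurable_likelihood _ _).ennreal_ofReal
  have hd : ∀ x, ENNReal.ofReal (likelihood (succCount h) (failCount h) x
      / evidence (succCount h) (failCount h))
      = (ENNReal.ofReal (histEvidence h))⁻¹ * ENNReal.ofReal (histLik h x) := by
    intro x
    rw [ENNReal.ofReal_div_of_pos (evidence_pos _ _), div_eq_mul_inv, mul_comm]
    rfl
  rw [posterior, Measure.map_apply measurable_fst hs,
    cond_apply (measurable_snd (measurableSet_singleton h)), histLaw_singleton,
    histLaw_prod_singleton π h hs, histPost, betaPost, withDensity_apply _ hs]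
  simp only [hd]
  rw [lintegral_const_mul _ hm, ENNReal.mul_inv (Or.inl hp) (Or.inl (policyProb_ne_top π t h)),
    mul_comm (policyProb π t h)⁻¹, mul_assoc, ← mul_assoc (policyProb π t h)⁻¹,
    ENNReal.inv_mul_cancel hp (policyProb_ne_top π t h), one_mul]

/-! ### Rewards and the decomposition of the regret over histories. -/

/-- The expected reward of an action, given the parameters. -/
noncomputable def meanReward (a : Action N) (x : Params N) : ℝ :=
  ∫ o, reward a o x.1 ∂(obsKernel N (x, a))

theorem meanReward_eq (a : Action N) (x : Params N) :
    meanReward a x = successProb x a * reward a true x.1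
      + (1 - successProb x a) * reward a false x.1 :=
  integral_bernoulliMeasure true false (successProb x a) _

theorem measurable_reward (a : Action N) (o : Bool) :
    Measurable fun x : Params N => reward a o x.1 := by
  rcases a with a | a
  · cases o
    · simp only [reward, Bool.false_eq_true, if_false]; fun_prop
    · simp only [reward, if_true]; fun_prop
  · exact measurable_const

@[fun_prop]
theorem measurable_meanReward (a : Action N) : Measurable (meanReward a) := by
  have : meanReward a = fun x => successProb x a * reward a true x.1
      + (1 - successProb x a) * reward a false x.1 := funext (meanReward_eq a)
  rw [this]
  have := measurable_reward a true
  have := measurable_reward a false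
  fun_prop

@[fun_prop]
theorem measurable_optReward : Measurable (optReward : Params N → ℝ) :=
  Measurable.iSup fun a => measurable_meanReward a

theorem abs_reward_le (a : Action N) (o : Bool) (θ : Fin N → I) : |reward a o θ| ≤ 1 := by
  rcases a with a | a
  · have h0 := (θ a).2.1
    have h1 := (θ a).2.2
    cases o <;> simp only [reward] <;> rw [abs_le] <;> constructor <;> simp <;> linarith
  · simp [reward]

theorem abs_meanReward_le (a : Action N) (x : Params N) : |meanReward a x| ≤ 1 := by
  rw [meanReward_eq]
  have h0 := (successProb x a).2.1
  have h1 := (successProb x a).2.2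
  obtain ⟨l1, u1⟩ := abs_le.1 (abs_reward_le a true x.1)
  obtain ⟨l2, u2⟩ := abs_le.1 (abs_reward_le a false x.1)
  rw [abs_le]
  constructor <;> nlinarith

theorem abs_optReward_le [Nonempty (Fin N)] (x : Params N) : |optReward x| ≤ 1 := by
  rw [abs_le]
  constructor
  · obtain ⟨a⟩ := (inferInstance : Nonempty (Action N))
    exact (abs_le.1 (abs_meanReward_le a x)).1.trans
      (le_ciSup (f := fun a => meanReward a x) (Set.finite_range _).bddAbove a)
  · exact ciSup_le fun a => (abs_le.1 (abs_meanReward_le a x)).2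

theorem integral_roundKernel (p : PMF (Action N)) (x : Params N) (c : ℝ) :
    ∫ b, (c - reward b.1 b.2 x.1) ∂roundKernel p x
      = c - ∑ a, (p a).toReal * meanReward a x := by
  rw [integral_sub (integrable_const _) .of_finite, integral_const, probReal_univ, one_smul,
    integral_fintype .of_finite, Fintype.sum_prod_type]
  congr 1
  refine Finset.sum_congr rfl fun a _ => ?_
  have hr : ∀ o, (roundKernel p x).real {(a, o)}
      = (p a).toReal * obsProb (successProb x a) o := fun o => by
    rw [measureReal_def, roundKernel_singleton, ENNReal.toReal_mul, ENNReal.toReal_ofReal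
      (obsProb_nonneg (successProb x a).2.1 (successProb x a).2.2 o)]
  simp only [hr, Fintype.sum_bool, meanReward_eq, smul_eq_mul, obsProb_true, obsProb_false]
  ring

/-- The expected regret of a round, under the law `μ` of the parameters, of drawing the action
from `p`. -/
noncomputable def roundRegret (μ : Measure (Params N)) (p : PMF (Action N)) : ℝ :=
  ∫ x, (optReward x - ∑ a, (p a).toReal * meanReward a x) ∂μ

theorem integrable_regret [Nonempty (Fin N)] {X : Type*} [MeasurableSpace X] {f : X → Params N}
    (hf : Measurable f) (μ : Measure (X × (Action N × Bool))) [IsFiniteMeasure μ] :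
    Integrable (fun z => optReward (f z.1) - reward z.2.1 z.2.2 (f z.1).1) μ := by
  refine integrable_of_bounded (c := 2) ?_ fun z => ?_
  · refine measurable_from_prod_countable_left fun b => ?_
    exact (measurable_optReward.comp hf).sub ((measurable_reward b.1 b.2).comp hf)
  · refine (abs_sub _ _).trans ?_
    linarith [abs_optReward_le (f z.1), abs_reward_le z.2.1 z.2.2 (f z.1).1]

theorem integral_compProd_roundKernel [Nonempty (Fin N)] (μ : Measure (Params N))
    [IsProbabilityMeasure μ] (p : PMF (Action N)) :
    ∫ z, (optReward z.1 - reward z.2.1 z.2.2 z.1.1) ∂(μ ⊗ₘ roundKernel p) = roundRegret μ p := by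
  rw [Measure.integral_compProd (integrable_regret (f := fun x => x) measurable_id _),
    roundRegret]
  simp only [integral_roundKernel]

instance (π : Agent N) (t : ℕ) : IsProbabilityMeasure (histLaw π t) := by
  unfold histLaw; infer_instance

instance (π : Agent N) (t : ℕ) : IsProbabilityMeasure (stepLaw π t) := by
  unfold stepLaw; infer_instance

/-- The probability that the history `h` occurs. -/
noncomputable def histProb (π : Agent N) (t : ℕ) (h : Hist N t) : ℝ :=
  (policyProb π t h).toReal * histEvidence h

theorem histProb_nonneg (π : Agent N) (h : Hist N t) : 0 ≤ histProb π t h :=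
  mul_nonneg ENNReal.toReal_nonneg (evidence_pos _ _).le

theorem histLaw_ne_zero_of_histProb_ne_zero (π : Agent N) (h : Hist N t)
    (hh : histProb π t h ≠ 0) : histLaw π t (Prod.snd ⁻¹' {h}) ≠ 0 := by
  rw [histLaw_singleton]
  refine mul_ne_zero (fun h0 => hh ?_) ?_
  · rw [histProb, h0, ENNReal.toReal_zero, zero_mul]
  · exact (ENNReal.ofReal_pos.2 (evidence_pos _ _)).ne'

theorem measurable_roundMean (p : PMF (Action N)) :
    Measurable fun x : Params N => optReward x - ∑ a, (p a).toReal * meanReward a x := by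
  fun_prop

theorem sum_toReal_pmf (p : PMF (Action N)) : ∑ a, (p a).toReal = 1 := by
  rw [← ENNReal.toReal_sum fun a _ => PMF.apply_ne_top p a, ← tsum_fintype (L := .unconditional _), p.tsum_coe,
    ENNReal.toReal_one]

theorem abs_roundMean_le [Nonempty (Fin N)] (p : PMF (Action N)) (x : Params N) :
    |optReward x - ∑ a, (p a).toReal * meanReward a x| ≤ 2 := by
  refine (abs_sub _ _).trans ?_
  have : |∑ a, (p a).toReal * meanReward a x| ≤ 1 := by
    refine (Finset.abs_sum_le_sum_abs _ _).trans ?_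
    rw [← sum_toReal_pmf p]
    refine Finset.sum_le_sum fun a _ => ?_
    rw [abs_mul, abs_of_nonneg ENNReal.toReal_nonneg]
    exact mul_le_of_le_one_right ENNReal.toReal_nonneg (abs_meanReward_le a x)
  linarith [abs_optReward_le x]

/-- The normalisation of `histPost` cancels the evidence in `histProb`. Unreachable histories have
weight zero, so `histPost` may stand for the posterior everywhere. -/
theorem integral_stepLaw [Nonempty (Fin N)] (π : Agent N) (t : ℕ) :
    ∫ z, (optReward z.1.1 - reward z.2.1 z.2.2 z.1.1.1) ∂(stepLaw π t)
      = ∑ h, histProb π t h * roundRegret (histPost h) (π t h) := by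
  rw [stepLaw, Measure.integral_compProd
    (integrable_regret (X := Params N × Hist N t) measurable_fst _)]
  have h1 : ∀ z : Params N × Hist N t,
      ∫ b, (optReward z.1 - reward b.1 b.2 z.1.1) ∂stepKernel π t z
        = optReward z.1 - ∑ a, (π t z.2 a).toReal * meanReward a z.1 := fun z =>
    integral_roundKernel (π t z.2) z.1 _
  simp only [h1]
  rw [histLaw, Measure.integral_compProd]
  · simp only [integral_fintype Integrable.of_finite]
    rw [integral_finsetSum]
    · refine Finset.sum_congr rfl fun h _ => ?_
      have h2 : ∀ x : Params N, (histKernel π t x).real {h}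
          = (policyProb π t h).toReal * histLik h x := fun x => by
        rw [measureReal_def, histKernel_singleton, ENNReal.toReal_mul,
          ENNReal.toReal_ofReal (histLik_nonneg _ x)]
      rw [roundRegret, integral_betaPost, histProb, histEvidence]
      simp only [h2, smul_eq_mul, mul_assoc]
      rw [integral_const_mul, mul_div_cancel₀ _ (evidence_pos _ _).ne']
      simp only [histLik, mul_comm]
    · intro h _
      refine integrable_of_bounded (c := 1 * 2) ?_ fun x => ?_
      · exact ((histKernel π t).measurable_coe (measurableSet_singleton h)).ennreal_toReal.smul
          (measurable_roundMean _)
      · rw [smul_eq_mul, abs_mul, abs_of_nonneg measureReal_nonneg]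
        exact mul_le_mul measureReal_le_one (abs_roundMean_le _ x) (abs_nonneg _) zero_le_one
  · refine integrable_of_bounded (c := 2) ?_ fun z => abs_roundMean_le (π t z.2) z.1
    exact measurable_from_prod_countable_left fun h => measurable_roundMean (π t h)

theorem sum_histProb_extend (π : Agent N) (h : Hist N t) (a : Action N) :
    ∑ o, histProb π (t + 1) (extend (h, (a, o))) = histProb π t h * (π t h a).toReal := by
  simp only [histProb, policyProb_extend]
  rw [← Finset.mul_sum, sum_histEvidence_extend, ENNReal.toReal_mul]
  ring

theorem sum_histProb_succ (π : Agent N) (t : ℕ) (F : Hist N (t + 1) → ℝ) :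
    ∑ h, histProb π (t + 1) h * F h
      = ∑ h, ∑ a, ∑ o, histProb π (t + 1) (extend (h, (a, o))) * F (extend (h, (a, o))) := by
  rw [← extend_bijective.sum_comp, Fintype.sum_prod_type]
  exact Finset.sum_congr rfl fun h _ => by rw [Fintype.sum_prod_type]

theorem sum_histProb (π : Agent N) : ∀ t, ∑ h, histProb π t h = 1
  | 0 => by
    simp [histProb, policyProb, histEvidence, evidence, succCount, failCount, betaInt]
  | t + 1 => by
    have := sum_histProb_succ π t fun _ => 1
    simp only [mul_one] at this
    rw [this]
    simp only [sum_histProb_extend, ← Finset.mul_sum, sum_toReal_pmf, mul_one]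
    exact sum_histProb π t

/-! ### The total information budget. -/

/-- The potential whose expected increments bound the information gained in each round. -/
noncomputable def potential (h : Hist N t) : ℝ :=
  ∑ a, Real.log (succCount h a + failCount h a + 2)

/-- Only the summand of the chosen action changes, whatever the observation, and `log (n + 3) - log
(n + 2) ≥ 1 / (n + 3)`. -/
theorem potential_extend (h : Hist N t) (a : Action N) (o : Bool) :
    potential h + 1 / (succCount h a + failCount h a + 3) ≤ potential (extend (h, (a, o))) := by
  have hc : ∀ c, (succCount (extend (h, (a, o))) c + failCount (extend (h, (a, o))) c : ℝ)
      = succCount h c + failCount h c + if c = a then 1 else 0 := by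
    intro c
    rw [succCount_extend, failCount_extend]
    by_cases hc : c = a
    · subst hc
      cases o <;> simp <;> ring
    · have : a ≠ c := fun h => hc h.symm
      simp [hc, this]
  simp only [potential, hc]
  rw [← Finset.add_sum_erase _ (fun c => Real.log (succCount h c + failCount h c + 2))
      (Finset.mem_univ a),
    ← Finset.add_sum_erase _ (fun c => Real.log (succCount h c + failCount h c
      + (if c = a then 1 else 0) + 2)) (Finset.mem_univ a)]
  simp only
  have he : ∑ c ∈ Finset.univ.erase a,
      Real.log (succCount h c + failCount h c + (if c = a then 1 else 0) + 2)
      = ∑ c ∈ Finset.univ.erase a, Real.log (succCount h c + failCount h c + 2) :=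
    Finset.sum_congr rfl fun c hc => by rw [if_neg (Finset.ne_of_mem_erase hc), add_zero]
  rw [he, if_pos trivial]
  set n : ℝ := succCount h a + failCount h a with hn
  have hn0 : 0 ≤ n := by positivity
  have hl := Real.one_sub_inv_le_log_of_pos (x := (n + 3) / (n + 2)) (by positivity)
  rw [Real.log_div (by positivity) (by positivity)] at hl
  have e : 1 - ((n + 3) / (n + 2))⁻¹ = 1 / (n + 3) := by
    field_simp; ring
  have e2 : n + 1 + 2 = n + 3 := by ring
  rw [e] at hl
  rw [e2]
  linarith

/-- The information, in nats, that a round after the history `h` carries on the parameters when the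
action is drawn from `p`. -/
noncomputable def roundInfo (h : Hist N t) (p : PMF (Action N)) : ℝ :=
  ∑ a, (p a).toReal * obsInfo (succCount h) (failCount h) a

theorem histProb_mul_roundInfo_le (π : Agent N) (t : ℕ) :
    ∑ h, histProb π t h * roundInfo h (π t h)
      ≤ ∑ h, histProb π (t + 1) h * potential h - ∑ h, histProb π t h * potential h := by
  rw [sum_histProb_succ, ← Finset.sum_sub_distrib]
  refine Finset.sum_le_sum fun h _ => ?_
  have h1 : ∀ a, ∑ o, histProb π (t + 1) (extend (h, (a, o)))
      * (potential h + 1 / (succCount h a + failCount h a + 3))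
      ≤ ∑ o, histProb π (t + 1) (extend (h, (a, o))) * potential (extend (h, (a, o))) := fun a =>
    Finset.sum_le_sum fun o _ =>
      mul_le_mul_of_nonneg_left (potential_extend h a o) (histProb_nonneg _ _)
  have h2 := Finset.sum_le_sum fun a (_ : a ∈ Finset.univ) => h1 a
  simp only [← Finset.sum_mul, sum_histProb_extend] at h2
  refine le_trans ?_ (sub_le_sub_right h2 _)
  simp only [mul_add, Finset.sum_add_distrib, mul_assoc, ← Finset.mul_sum, ← Finset.sum_mul,
    sum_toReal_pmf]
  rw [one_mul, add_sub_cancel_left]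
  refine mul_le_mul_of_nonneg_left ?_ (histProb_nonneg _ _)
  exact Finset.sum_le_sum fun a _ =>
    mul_le_mul_of_nonneg_left (obsInfo_le _ _ a) ENNReal.toReal_nonneg

/-- The expected potential telescopes: it starts at `log 2` per action, and no count exceeds `T` at
the end. -/
theorem sum_roundInfo_le (π : Agent N) (T : ℕ) :
    ∑ t ∈ Finset.range T, ∑ h, histProb π t h * roundInfo h (π t h)
      ≤ Fintype.card (Action N) * Real.log ((T + 2) / 2) := by
  refine (Finset.sum_le_sum fun t _ => histProb_mul_roundInfo_le π t).trans ?_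
  rw [Finset.sum_range_sub fun t => ∑ h, histProb π t h * potential h,
    Real.log_div (by positivity) two_ne_zero, mul_sub]
  refine sub_le_sub ?_ (le_of_eq ?_)
  · have : ∀ h : Hist N T, potential h ≤ Fintype.card (Action N) * Real.log (T + 2) := by
      intro h
      rw [← nsmul_eq_mul]
      refine Finset.sum_le_card_nsmul _ _ _ fun a _ => ?_
      have h1 : (succCount h a + failCount h a : ℝ) ≤ T := by
        exact_mod_cast succCount_add_failCount_le h a
      exact Real.log_le_log (by positivity) (by linarith)
    calc ∑ h, histProb π T h * potential h
        ≤ ∑ h, histProb π T h * (Fintype.card (Action N) * Real.log (T + 2)) :=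
          Finset.sum_le_sum fun h _ => mul_le_mul_of_nonneg_left (this h) (histProb_nonneg _ _)
      _ = _ := by rw [← Finset.sum_mul, sum_histProb, one_mul]
  · have : ∀ h : Hist N 0, potential h = Fintype.card (Action N) * Real.log 2 := by
      intro h
      simp [potential, succCount, failCount]
    simp only [this, ← Finset.sum_mul, sum_histProb, one_mul]

end

/-! ### The comparison law and its information ratio. -/

section

variable {N t : ℕ}

/-- The Cauchy-Schwarz inequality for bounded functions. -/
theorem sq_integral_mul_le {X : Type*} [MeasurableSpace X] (μ : Measure X) [IsFiniteMeasure μ]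
    {w g : X → ℝ} (hw : Measurable w) (hg : Measurable g) {c d : ℝ} (hwc : ∀ x, |w x| ≤ c)
    (hgd : ∀ x, |g x| ≤ d) : (∫ x, w x * g x ∂μ) ^ 2 ≤ (∫ x, w x ^ 2 ∂μ) * ∫ x, g x ^ 2 ∂μ := by
  have iw : Integrable (fun x => w x ^ 2) μ :=
    integrable_of_bounded (by fun_prop) (c := c ^ 2) fun x => by
      rw [abs_pow]; exact pow_le_pow_left₀ (abs_nonneg _) (hwc x) 2
  have ig : Integrable (fun x => g x ^ 2) μ :=
    integrable_of_bounded (by fun_prop) (c := d ^ 2) fun x => by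
      rw [abs_pow]; exact pow_le_pow_left₀ (abs_nonneg _) (hgd x) 2
  have iwg : Integrable (fun x => w x * g x) μ :=
    integrable_of_bounded (by fun_prop) (c := c * d) fun x => by
      rw [abs_mul]
      exact mul_le_mul (hwc x) (hgd x) (abs_nonneg _) ((abs_nonneg _).trans (hwc x))
  have key : ∀ l : ℝ, 0 ≤ (∫ x, w x ^ 2 ∂μ) * (l * l) + (2 * ∫ x, w x * g x ∂μ) * l
      + ∫ x, g x ^ 2 ∂μ := by
    intro l
    have h : ∫ x, (l * w x + g x) ^ 2 ∂μ = (∫ x, w x ^ 2 ∂μ) * (l * l)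
        + (2 * ∫ x, w x * g x ∂μ) * l + ∫ x, g x ^ 2 ∂μ := by
      have e : ∀ x, (l * w x + g x) ^ 2 = l * l * w x ^ 2 + 2 * l * (w x * g x) + g x ^ 2 :=
        fun x => by ring
      have i1 : Integrable (fun x => l * l * w x ^ 2 + 2 * l * (w x * g x)) μ :=
        (iw.const_mul _).add (iwg.const_mul _)
      simp only [e]
      rw [integral_add i1 ig, integral_add (iw.const_mul _) (iwg.const_mul _),
        integral_const_mul, integral_const_mul]
      ring
    rw [← h]
    exact integral_nonneg fun x => sq_nonneg _
  have := discrim_le_zero key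
  rw [discrim] at this
  linarith

theorem meanReward_inl (a : Fin N) (x : Params N) :
    meanReward (Sum.inl a) x = (successProb x (Sum.inl a) : ℝ) * successProb x (Sum.inr a)
      + (1 - successProb x (Sum.inl a)) * (1 - successProb x (Sum.inr a)) := by
  rw [meanReward_eq]
  simp [reward, successProb]

theorem meanReward_inr (a : Fin N) (x : Params N) : meanReward (Sum.inr a) x = -1 := by
  rw [meanReward_eq]
  simp only [reward]
  ring

/-- There is a measurable choice of an optimal arm. -/
theorem exists_measurable_bestArm [Nonempty (Fin N)] : ∃ f : Params N → Fin N, Measurable f ∧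
    ∀ x, optReward x = meanReward (Sum.inl (f x)) x := by
  classical
  have hne : ∀ x : Params N, (Finset.univ.filter fun a : Fin N =>
      ∀ b : Fin N, meanReward (Sum.inl b) x ≤ meanReward (Sum.inl a) x).Nonempty := by
    intro x
    obtain ⟨a, -, ha⟩ := Finset.exists_max_image (Finset.univ : Finset (Fin N))
      (fun a => meanReward (Sum.inl a) x) Finset.univ_nonempty
    exact ⟨a, by simpa using ha⟩
  -- Ties go to the smallest index, so each fibre is a finite Boolean combination of measurable
  -- comparisons.
  refine ⟨fun x => (Finset.univ.filter fun a : Fin N =>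
      ∀ b : Fin N, meanReward (Sum.inl b) x ≤ meanReward (Sum.inl a) x).min' (hne x), ?_, ?_⟩
  · refine measurable_to_countable' fun a => ?_
    have : (fun x : Params N => (Finset.univ.filter fun a : Fin N =>
        ∀ b : Fin N, meanReward (Sum.inl b) x ≤ meanReward (Sum.inl a) x).min' (hne x)) ⁻¹' {a}
        = (⋂ b : Fin N, {x | meanReward (Sum.inl b) x ≤ meanReward (Sum.inl a) x})
          ∩ ⋂ c : Fin N, ⋂ _ : c < a,
            (⋂ b : Fin N, {x | meanReward (Sum.inl b) x ≤ meanReward (Sum.inl c) x})ᶜ := by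
      ext x
      simp only [Set.mem_preimage, Set.mem_singleton_iff, Set.mem_inter_iff, Set.mem_iInter,
        Set.mem_compl_iff, Set.mem_ofPred_eq]
      rw [Finset.min'_eq_iff]
      simp only [Finset.mem_filter, Finset.mem_univ, true_and]
      exact and_congr_right fun _ => forall_congr' fun c => by
        rw [← not_lt, imp_not_comm]
    rw [this]
    have hm : ∀ c : Fin N, MeasurableSet
        (⋂ b : Fin N, {x : Params N | meanReward (Sum.inl b) x ≤ meanReward (Sum.inl c) x}) :=
      fun c => MeasurableSet.iInter fun b =>
        measurableSet_le (measurable_meanReward _) (measurable_meanReward _)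
    exact (hm a).inter (MeasurableSet.iInter fun c => MeasurableSet.iInter fun _ => (hm c).compl)
  · intro x
    have hmem := Finset.min'_mem _ (hne x)
    simp only [Finset.mem_filter, Finset.mem_univ, true_and] at hmem
    refine le_antisymm (ciSup_le fun a => ?_)
      (le_ciSup (f := fun a => meanReward a x) (Set.finite_range _).bddAbove _)
    rcases a with a | a
    · exact hmem a
    -- A query earns `-1`, the least possible reward, so it never beats an arm.
    · change meanReward (Sum.inr a) x ≤ _
      rw [meanReward_inr]
      exact (abs_le.1 (abs_meanReward_le _ x)).1

/-- The law that draws an arm from `P` and then pulls it with the probability `1 - ε` and queries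
the human about it with the probability `ε`. -/
noncomputable def mixture (P : Fin N → ℝ) (hP0 : ∀ a, 0 ≤ P a) (hP : ∑ a, P a = 1) {ε : ℝ}
    (hε0 : 0 < ε) (hε1 : ε < 1) : PMF (Action N) :=
  PMF.ofFintype (fun b => ENNReal.ofReal
    (Sum.elim (fun a => (1 - ε) * P a) (fun a => ε * P a) b)) (by
      rw [← ENNReal.ofReal_sum_of_nonneg, Fintype.sum_sum_type]
      · simp only [Sum.elim_inl, Sum.elim_inr, ← Finset.mul_sum, hP]
        simp
      · rintro (a | a) -
        · exact mul_nonneg (by linarith) (hP0 a)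
        · exact mul_nonneg hε0.le (hP0 a))

section mixture

variable {P : Fin N → ℝ} (hP0 : ∀ a, 0 ≤ P a) (hP : ∑ a, P a = 1) {ε : ℝ}
  (hε0 : 0 < ε) (hε1 : ε < 1)

theorem toReal_mixture_inl (a : Fin N) :
    (mixture P hP0 hP hε0 hε1 (Sum.inl a)).toReal = (1 - ε) * P a :=
  ENNReal.toReal_ofReal (mul_nonneg (by linarith) (hP0 a))

theorem toReal_mixture_inr (a : Fin N) :
    (mixture P hP0 hP hε0 hε1 (Sum.inr a)).toReal = ε * P a :=
  ENNReal.toReal_ofReal (mul_nonneg hε0.le (hP0 a))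

end mixture

theorem integral_betaPost_meanReward (s f : Action N → ℕ) (a : Fin N) :
    ∫ x, meanReward (Sum.inl a) x ∂betaPost s f
      = postMean s f (Sum.inl a) * postMean s f (Sum.inr a)
        + (1 - postMean s f (Sum.inl a)) * (1 - postMean s f (Sum.inr a)) := by
  have hi : ∀ b : Action N, Integrable (fun x : Params N => (successProb x b : ℝ)) (betaPost s f) :=
    fun b => by simpa using integrable_successProb_pow b 1 (μ := betaPost s f)
  have hne : (Sum.inl a : Action N) ≠ Sum.inr a := by simp
  have h1 := integral_betaPost_mul s f hne (fun y => (y : ℝ)) (fun y => (y : ℝ))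
  have h2 := integral_betaPost_mul s f hne (fun y => 1 - (y : ℝ)) (fun y => 1 - (y : ℝ))
  have h3 : ∀ b : Action N, ∫ x, (1 - (successProb x b : ℝ)) ∂betaPost s f
      = 1 - postMean s f b := fun b => by
    rw [integral_sub (integrable_const _) (hi b), integral_betaPost_successProb]
    simp
  simp only [meanReward_inl]
  rw [integral_add, h1, h2, h3, h3, integral_betaPost_successProb, integral_betaPost_successProb]
  · refine integrable_of_bounded (by fun_prop) (c := 1) fun x => ?_
    rw [abs_of_nonneg (mul_nonneg (successProb x _).2.1 (successProb x _).2.1)]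
    exact mul_le_one₀ (successProb x _).2.2 (successProb x _).2.1 (successProb x _).2.2
  · refine integrable_of_bounded (by fun_prop) (c := 1) fun x => ?_
    have h0 : ∀ b, 0 ≤ 1 - (successProb x b : ℝ) := fun b => by linarith [(successProb x b).2.2]
    have h1 : ∀ b, 1 - (successProb x b : ℝ) ≤ 1 := fun b => by linarith [(successProb x b).2.1]
    rw [abs_of_nonneg (mul_nonneg (h0 _) (h0 _))]
    exact mul_le_one₀ (h1 _) (h0 _) (h1 _)

/-- The arm that an action is about. -/
def armOf : Action N → Fin N := Sum.elim id id

/-- The expected regret of Thompson sampling is controlled by the posterior variances. -/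
theorem sq_thompson_regret_le (s f : Action N → ℕ) {k : Params N → Fin N} (hk : Measurable k)
    (hopt : ∀ x, optReward x = meanReward (Sum.inl (k x)) x) :
    (∫ x, (optReward x - ∑ a, (betaPost s f).real (k ⁻¹' {a}) * meanReward (Sum.inl a) x)
        ∂betaPost s f) ^ 2
      ≤ Fintype.card (Action N) * ∑ b : Action N, (betaPost s f).real (k ⁻¹' {armOf b})
          * ∫ x, ((successProb x b : ℝ) - postMean s f b) ^ 2 ∂betaPost s f := by
  classical
  set μ := betaPost s f with hμ
  set w : Fin N → Params N → ℝ := fun a => (k ⁻¹' {a}).indicator 1 with hw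
  have hS : ∀ a, MeasurableSet (k ⁻¹' {a}) := fun a => hk (measurableSet_singleton a)
  have hwm : ∀ a, Measurable (w a) := fun a => measurable_one.indicator (hS a)
  have hw1 : ∀ a x, |w a x| ≤ 1 := fun a x => by
    by_cases h : x ∈ k ⁻¹' {a} <;> simp [hw, h]
  have hwsq : ∀ a x, w a x ^ 2 = w a x := fun a x => by
    by_cases h : x ∈ k ⁻¹' {a} <;> simp [hw, h]
  have hwi : ∀ a, ∫ x, w a x ∂μ = μ.real (k ⁻¹' {a}) := fun a => by
    rw [hw]; exact integral_indicator_one (hS a)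
  set m := postMean s f with hm
  have hmb : ∀ b, |2 * m b - 1| ≤ 1 := fun b => by
    rw [abs_le]
    constructor <;> linarith [postMean_pos s f b, postMean_lt_one s f b]
  have hqb : ∀ (x : Params N) (b : Action N), |2 * (successProb x b : ℝ) - 1| ≤ 1 := fun x b => by
    rw [abs_le]
    constructor <;> linarith [(successProb x b).2.1, (successProb x b).2.2]
  have hdb : ∀ (x : Params N) (b : Action N), |(successProb x b : ℝ) - m b| ≤ 1 := fun x b => by
    rw [abs_le]
    constructor <;> linarith [(successProb x b).2.1, (successProb x b).2.2,
      postMean_pos s f b, postMean_lt_one s f b]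
  -- With `r` the mean reward of an arm, `r - E r = (φ - E φ) * (2 * θ - 1) + (2 * E φ - 1) * (θ - E
  -- θ)`: one centred term per action, each with a factor bounded by `1`. Posterior independence of
  -- `φ` and `θ` enters through `E r`.
  set g : Action N → Params N → ℝ := fun b x => ((successProb x b : ℝ) - m b)
    * Sum.elim (fun a => 2 * (successProb x (Sum.inr a) : ℝ) - 1)
        (fun a => 2 * m (Sum.inl a) - 1) b with hg
  have hgm : ∀ b, Measurable (g b) := by
    rintro (a | a) <;> simp only [hg, Sum.elim_inl, Sum.elim_inr] <;> fun_prop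
  have hfac : ∀ (b : Action N) (x : Params N), |Sum.elim (fun a => 2 * (successProb x (Sum.inr a) : ℝ) - 1)
        (fun a => 2 * m (Sum.inl a) - 1) b| ≤ 1 := by
    rintro (a | a) x
    · exact hqb x _
    · exact hmb _
  have hgle : ∀ b x, |g b x| ≤ |(successProb x b : ℝ) - m b| := fun b x => by
    rw [hg, abs_mul]
    exact mul_le_of_le_one_right (abs_nonneg _) (hfac b x)
  have hg1 : ∀ b x, |g b x| ≤ 1 := fun b x => (hgle b x).trans (hdb x b)
  have hwgi : ∀ a b, Integrable (fun x => w a x * g b x) μ := fun a b =>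
    integrable_of_bounded ((hwm a).mul (hgm b)) (c := 1 * 1) fun x => by
      rw [abs_mul]
      exact mul_le_mul (hw1 a x) (hg1 b x) (abs_nonneg _) zero_le_one
  have hri : ∀ a : Action N, Integrable (meanReward a) μ := fun a =>
    integrable_of_bounded (measurable_meanReward a) (abs_meanReward_le a)
  have hwri : ∀ a, Integrable (fun x => w a x * meanReward (Sum.inl a) x) μ := fun a =>
    integrable_of_bounded ((hwm a).mul (measurable_meanReward _)) (c := 1 * 1) fun x => by
      rw [abs_mul]
      exact mul_le_mul (hw1 a x) (abs_meanReward_le _ x) (abs_nonneg _) zero_le_one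
  have hwint : ∀ a, Integrable (w a) μ := fun a => integrable_of_bounded (hwm a) (hw1 a)
  -- Thompson sampling draws the arm with the law of the optimal arm but independently of the
  -- parameters, so its regret is the sum over arms of `E[1_{k = a} * (r_a - E r_a)]`.
  have hX : ∫ x, (optReward x - ∑ a, μ.real (k ⁻¹' {a}) * meanReward (Sum.inl a) x) ∂μ
      = ∑ b : Action N, ∫ x, w (armOf b) x * g b x ∂μ := by
    have ho : ∀ x, optReward x = ∑ a, w a x * meanReward (Sum.inl a) x := by
      intro x
      rw [hopt, Finset.sum_eq_single (k x)]
      · simp [hw]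
      · intro a _ ha
        simp [hw, ha.symm]
      · simp
    simp only [ho]
    rw [← integral_finsetSum _ fun b _ => hwgi (armOf b) b]
    rw [integral_sub (integrable_finsetSum _ fun a _ => hwri a)
      (integrable_finsetSum _ fun a _ => (hri _).const_mul _),
      integral_finsetSum _ (fun a _ => (hri _).const_mul _)]
    simp only [integral_const_mul]
    simp only [hμ, integral_betaPost_meanReward]
    simp only [← hμ, ← hwi, ← integral_mul_const]
    rw [← integral_finsetSum _ fun a _ => (hwint a).mul_const _,
      ← integral_sub (integrable_finsetSum _ fun a _ => hwri a)
        (integrable_finsetSum _ fun a _ => (hwint a).mul_const _)]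
    congr 1
    ext x
    rw [Fintype.sum_sum_type, ← Finset.sum_sub_distrib, ← Finset.sum_add_distrib]
    refine Finset.sum_congr rfl fun a _ => ?_
    simp only [armOf, hg, Sum.elim_inl, Sum.elim_inr, id, meanReward_inl, ← hm]
    ring
  rw [hX]
  -- Cauchy-Schwarz over the actions produces the cardinality; a second one, inside each integral,
  -- turns the indicator into the probability of its arm.
  refine (sq_sum_le_card_mul_sum_sq).trans ?_
  rw [Finset.card_univ]
  refine mul_le_mul_of_nonneg_left (Finset.sum_le_sum fun b _ => ?_) (Nat.cast_nonneg _)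
  refine (sq_integral_mul_le μ (hwm _) (hgm b) (hw1 _) (hg1 b)).trans ?_
  simp only [hwsq, hwi]
  refine mul_le_mul_of_nonneg_left ?_ measureReal_nonneg
  refine integral_mono_of_nonneg (ae_of_all _ fun x => sq_nonneg _) (integrable_sub_pow b _ 2)
    (ae_of_all _ fun x => ?_)
  exact sq_le_sq.2 (hgle b x)

theorem le_roundInfo (h : Hist N t) (p : PMF (Action N)) :
    1 / (4 * ((t : ℝ) + 3)) ≤ roundInfo h p := by
  have hc : ∑ a, (p a).toReal * (1 / (4 * ((t : ℝ) + 3))) = 1 / (4 * ((t : ℝ) + 3)) := by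
    rw [← Finset.sum_mul, sum_toReal_pmf, one_mul]
  rw [← hc, roundInfo]
  refine Finset.sum_le_sum fun a _ => mul_le_mul_of_nonneg_left ?_ ENNReal.toReal_nonneg
  refine le_trans ?_ (le_obsInfo _ _ a)
  have h1 : (succCount h a + failCount h a : ℝ) ≤ t := by
    exact_mod_cast succCount_add_failCount_le h a
  gcongr

theorem roundInfo_pos (h : Hist N t) (p : PMF (Action N)) : 0 < roundInfo h p :=
  lt_of_lt_of_le (by positivity) (le_roundInfo h p)

/-- Some action distribution has a small information ratio. -/
theorem exists_sq_roundRegret_le [Nonempty (Fin N)] (h : Hist N t) {ε : ℝ} (hε0 : 0 < ε)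
    (hε1 : ε < 1) : ∃ p : PMF (Action N), roundRegret (histPost h) p ^ 2
      ≤ (Fintype.card (Action N) * (1 - ε) ^ 2 / min ε (1 - ε) + 32 * ε ^ 2 * (t + 3))
        * roundInfo h p := by
  obtain ⟨k, hk, hopt⟩ := exists_measurable_bestArm (N := N)
  set μ := histPost h with hμ
  set P : Fin N → ℝ := fun a => μ.real (k ⁻¹' {a}) with hPdef
  have hP0 : ∀ a, 0 ≤ P a := fun a => measureReal_nonneg
  have hP : ∑ a, P a = 1 := by
    have := sum_measureReal_preimage_singleton (μ := μ) (f := k) Finset.univ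
      (fun a _ => hk (measurableSet_singleton a))
    rw [hPdef, this]
    simp
  set p := mixture P hP0 hP hε0 hε1 with hp
  refine ⟨p, ?_⟩
  set X := ∫ x, (optReward x - ∑ a, P a * meanReward (Sum.inl a) x) ∂μ with hX
  have hoi : Integrable (optReward : Params N → ℝ) μ :=
    integrable_of_bounded measurable_optReward abs_optReward_le
  have hri : ∀ a : Action N, Integrable (meanReward a) μ := fun a =>
    integrable_of_bounded (measurable_meanReward a) (abs_meanReward_le a)
  -- A query always costs `R* + 1`, whichever arm it is about.
  have hreg : roundRegret μ p = (1 - ε) * X + ε * ∫ x, (optReward x + 1) ∂μ := by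
    rw [hX, ← integral_const_mul, ← integral_const_mul, ← integral_add, roundRegret]
    · congr 1
      ext x
      rw [Fintype.sum_sum_type]
      simp only [hp, toReal_mixture_inl, toReal_mixture_inr, meanReward_inr, mul_assoc,
        ← Finset.mul_sum, ← Finset.sum_mul, hP]
      ring
    · exact (hoi.sub (integrable_finsetSum _ fun a _ => (hri _).const_mul _)).const_mul _
    · exact (hoi.add (integrable_const _)).const_mul _
  have hquery : (∫ x, (optReward x + 1) ∂μ) ^ 2 ≤ 4 := by
    have h0 : 0 ≤ ∫ x, (optReward x + 1) ∂μ := integral_nonneg fun x => by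
      have := (abs_le.1 (abs_optReward_le x)).1
      change 0 ≤ optReward x + 1
      linarith
    have h2 : ∫ x, (optReward x + 1) ∂μ ≤ ∫ _, (2 : ℝ) ∂μ :=
      integral_mono (hoi.add (integrable_const _)) (integrable_const _) fun x => by
        have := (abs_le.1 (abs_optReward_le x)).2
        change optReward x + 1 ≤ 2
        linarith
    rw [integral_const, probReal_univ, one_smul] at h2
    nlinarith
  have hmin : 0 < min ε (1 - ε) := lt_min hε0 (by linarith)
  -- The mixture gives both actions about an arm at least `min ε (1 - ε)` times its Thompson
  -- probability, so the weighted variances are dominated by the information; the `2` is Pinsker's.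
  have hXle : X ^ 2 ≤ Fintype.card (Action N) * (roundInfo h p / (2 * min ε (1 - ε))) := by
    refine (sq_thompson_regret_le (succCount h) (failCount h) hk hopt).trans ?_
    refine mul_le_mul_of_nonneg_left ?_ (Nat.cast_nonneg _)
    rw [le_div_iff₀ (by positivity), Finset.sum_mul, roundInfo]
    refine Finset.sum_le_sum fun b _ => ?_
    have hv := two_mul_variance_le_obsInfo (succCount h) (failCount h) b
    have hb : min ε (1 - ε) * P (armOf b) ≤ (p b).toReal := by
      rcases b with a | a
      · rw [hp, toReal_mixture_inl]
        exact mul_le_mul_of_nonneg_right (min_le_right _ _) (hP0 a)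
      · rw [hp, toReal_mixture_inr]
        exact mul_le_mul_of_nonneg_right (min_le_left _ _) (hP0 a)
    have hv0 : 0 ≤ ∫ x, ((successProb x b : ℝ) - postMean (succCount h) (failCount h) b) ^ 2
        ∂betaPost (succCount h) (failCount h) := integral_nonneg fun x => sq_nonneg _
    calc _ = (min ε (1 - ε) * P (armOf b)) * (2 * ∫ x, ((successProb x b : ℝ)
          - postMean (succCount h) (failCount h) b) ^ 2
            ∂betaPost (succCount h) (failCount h)) := by ring
      _ ≤ _ := mul_le_mul hb hv (by positivity) ENNReal.toReal_nonneg
  -- This converts the non-vanishing query cost into information, at a price growing with `t`.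
  have hinfo : 1 ≤ 4 * ((t : ℝ) + 3) * roundInfo h p := by
    have := le_roundInfo h p
    rw [div_le_iff₀ (by positivity)] at this
    linarith
  calc roundRegret μ p ^ 2
      ≤ 2 * (((1 - ε) * X) ^ 2 + (ε * ∫ x, (optReward x + 1) ∂μ) ^ 2) := by
        rw [hreg]; exact add_sq_le
    _ = 2 * ((1 - ε) ^ 2 * X ^ 2 + ε ^ 2 * (∫ x, (optReward x + 1) ∂μ) ^ 2) := by ring
    -- The constant `32` is `2 * 4 * 4`: the square of a sum, the squared query cost, and the lower
    -- bound on information.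
    _ ≤ 2 * ((1 - ε) ^ 2 * (Fintype.card (Action N) * (roundInfo h p / (2 * min ε (1 - ε))))
          + ε ^ 2 * (4 * (4 * ((t : ℝ) + 3) * roundInfo h p))) := by
        gcongr
        linarith
    _ = _ := by
        field_simp
        ring

theorem infoRatio_eq [Nonempty (Fin N)] (π : Agent N) (h : Hist N t)
    (hh : histLaw π t (Prod.snd ⁻¹' {h}) ≠ 0) (p : PMF (Action N)) :
    infoRatio π t h p = ENNReal.ofReal (roundRegret (histPost h) p ^ 2)
      / ENNReal.ofReal (roundInfo h p) := by
  have hk : ∀ a, 0 ≤ obsInfo (succCount h) (failCount h) a := fun a =>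
    le_trans (by positivity) (le_obsInfo _ _ a)
  rw [infoRatio, condStepLaw, posterior_eq_histPost π h hh, integral_compProd_roundKernel,
    mutualInfo_compProd_roundKernel _ p (postMean (succCount h) (failCount h))
      (integral_betaPost_successProb _ _) (postMean_pos _ _) (postMean_lt_one _ _), roundInfo,
    ENNReal.ofReal_sum_of_nonneg fun a _ => mul_nonneg ENNReal.toReal_nonneg (hk a)]
  congr 1
  refine Finset.sum_congr rfl fun a _ => ?_
  rw [ENNReal.ofReal_mul ENNReal.toReal_nonneg, ENNReal.ofReal_toReal (PMF.apply_ne_top p a)]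
  rfl

theorem sq_roundRegret_le_of_isIDS [Nonempty (Fin N)] {π : Agent N} (hπ : IsIDS π) (h : Hist N t)
    (hh : histLaw π t (Prod.snd ⁻¹' {h}) ≠ 0) {ε : ℝ} (hε0 : 0 < ε) (hε1 : ε < 1) :
    roundRegret (histPost h) (π t h) ^ 2
      ≤ (Fintype.card (Action N) * (1 - ε) ^ 2 / min ε (1 - ε) + 32 * ε ^ 2 * (t + 3))
        * roundInfo h (π t h) := by
  obtain ⟨p, hp⟩ := exists_sq_roundRegret_le h hε0 hε1
  have hle := hπ t h hh p
  rw [infoRatio_eq π h hh, infoRatio_eq π h hh, ← ENNReal.ofReal_div_of_pos (roundInfo_pos h _),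
    ← ENNReal.ofReal_div_of_pos (roundInfo_pos h _), ENNReal.ofReal_le_ofReal_iff
      (div_nonneg (sq_nonneg _) (roundInfo_pos h _).le)] at hle
  rw [← div_le_iff₀ (roundInfo_pos h _)]
  exact hle.trans ((div_le_iff₀ (roundInfo_pos h _)).2 hp)

/-! ### Summation over rounds and the final bound. -/

/-- After splitting off `log ((T + 2) / 2)` it remains that `2 * log ((T + 2) / 2) ≤ T * log (8 * T
/ (T + 2))`. Both sides compare with `2 * T * log (3 / 2)`: Bernoulli's inequality gives `1 + T / 2
≤ (3 / 2) ^ T`, and `8 * T / (T + 2) ≥ 8 / 3 ≥ 9 / 4`. -/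
theorem add_two_mul_log_le {T : ℕ} (hT : 1 ≤ T) :
    ((T : ℝ) + 2) * Real.log ((T + 2) / 2) ≤ T * Real.log (4 * T) := by
  have hT' : (1 : ℝ) ≤ T := by exact_mod_cast hT
  have h1 : Real.log (4 * T) = Real.log ((T + 2) / 2) + Real.log (8 * T / (T + 2)) := by
    rw [← Real.log_mul (by positivity) (by positivity)]
    congr 1
    field_simp
    ring
  have h2 : 2 * Real.log (3 / 2) ≤ Real.log (8 * T / (T + 2)) := by
    rw [← Real.log_rpow (by norm_num)]
    refine Real.log_le_log (by positivity) ?_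
    rw [le_div_iff₀ (by positivity)]
    norm_num
    linarith
  have h3 : Real.log ((T + 2) / 2) ≤ T * Real.log (3 / 2) := by
    rw [← Real.log_pow]
    refine Real.log_le_log (by positivity) ?_
    have := one_add_mul_le_pow (a := (1 / 2 : ℝ)) (by norm_num) T
    norm_num at this ⊢
    linarith
  rw [h1]
  nlinarith

/-- Cauchy-Schwarz twice: over the rounds, then over the histories, whose probabilities sum to one.
-/
theorem sq_regret_le [Nonempty (Fin N)] (π : Agent N) (T : ℕ) :
    regret π T ^ 2 ≤ T * ∑ t ∈ Finset.range T, ∑ h, histProb π t h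
      * roundRegret (histPost h) (π t h) ^ 2 := by
  rw [regret]
  refine sq_sum_le_card_mul_sum_sq.trans ?_
  rw [Finset.card_range]
  refine mul_le_mul_of_nonneg_left (Finset.sum_le_sum fun t _ => ?_) (Nat.cast_nonneg _)
  rw [integral_stepLaw]
  refine (Finset.sum_sq_le_sum_mul_sum_of_sq_le_mul Finset.univ
    (f := fun h => histProb π t h)
    (g := fun h => histProb π t h * roundRegret (histPost h) (π t h) ^ 2)
    (fun h _ => histProb_nonneg π h)
    (fun h _ => mul_nonneg (histProb_nonneg π h) (sq_nonneg _)) fun h _ => le_of_eq (by ring)).trans ?_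
  rw [sum_histProb, one_mul]

end

end BanditAlignment

theorem mainTheorem7 (N : ℕ) (hN : 1 ≤ N) (π : BanditAlignment.Agent N)
    (hπ : BanditAlignment.IsIDS π) (T : ℕ) (ε : ℝ) (hε0 : 0 < ε) (hε1 : ε < 1) :
    BanditAlignment.regret π T ≤
      √((Fintype.card (BanditAlignment.Action N) : ℝ) * T * (1 - ε) ^ 2 / min ε (1 - ε)
          + 32 * ε ^ 2 * (T : ℝ) ^ 2)
        * √((Fintype.card (BanditAlignment.Action N) : ℝ) * Real.log (4 * T)) := by
  open BanditAlignment in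
  have : Nonempty (Fin N) := ⟨⟨0, hN⟩⟩
  rcases Nat.eq_zero_or_pos T with rfl | hT
  -- The regret is an empty sum, and the bound is `0` too, with `Real.log 0 = 0`.
  · simp [regret]
  have hT' : (1 : ℝ) ≤ T := by exact_mod_cast hT
  have hmin : 0 < min ε (1 - ε) := lt_min hε0 (by linarith)
  set A : ℝ := ((Fintype.card (BanditAlignment.Action N) : ℕ) : ℝ) with hA
  have hA0 : 0 ≤ A := Nat.cast_nonneg _
  set C : ℝ := A * (1 - ε) ^ 2 / min ε (1 - ε) with hC
  have hC0 : 0 ≤ C := by positivity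
  have h1 : ∑ t ∈ Finset.range T, ∑ h, histProb π t h * roundRegret (histPost h) (π t h) ^ 2
      ≤ (C + 32 * ε ^ 2 * (T + 2)) * (A * Real.log ((T + 2) / 2)) := by
    refine le_trans ?_ (mul_le_mul_of_nonneg_left (sum_roundInfo_le π T) (by positivity))
    rw [Finset.mul_sum]
    refine Finset.sum_le_sum fun t ht => ?_
    rw [Finset.mul_sum]
    refine Finset.sum_le_sum fun h _ => ?_
    rw [mul_left_comm]
    -- The IDS property says nothing about unreachable histories, but these carry no weight.
    by_cases hh : histProb π t h = 0
    · simp [hh]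
    refine mul_le_mul_of_nonneg_left ?_ (histProb_nonneg π h)
    refine (sq_roundRegret_le_of_isIDS hπ h
      (histLaw_ne_zero_of_histProb_ne_zero π h hh) hε0 hε1).trans ?_
    have ht' : (t : ℝ) + 1 ≤ T := by exact_mod_cast Finset.mem_range.1 ht
    refine mul_le_mul_of_nonneg_right ?_ (roundInfo_pos h _).le
    -- The last round is `T - 1`, so `t + 3` is at most `T + 2`, the shift absorbed by
    -- `add_two_mul_log_le`.
    have : 32 * ε ^ 2 * ((t : ℝ) + 3) ≤ 32 * ε ^ 2 * (T + 2) :=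
      mul_le_mul_of_nonneg_left (by linarith) (by positivity)
    linarith
  have hlog0 : 0 ≤ Real.log (((T : ℝ) + 2) / 2) := Real.log_nonneg (by linarith)
  have hlog : Real.log (((T : ℝ) + 2) / 2) ≤ Real.log (4 * T) :=
    Real.log_le_log (by positivity) (by linarith)
  have h2 := add_two_mul_log_le hT
  have h3 : regret π T ^ 2 ≤ (A * T * (1 - ε) ^ 2 / min ε (1 - ε) + 32 * ε ^ 2 * (T : ℝ) ^ 2)
      * (A * Real.log (4 * T)) := by
    calc regret π T ^ 2
        ≤ T * ((C + 32 * ε ^ 2 * (T + 2)) * (A * Real.log ((T + 2) / 2))) :=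
          (sq_regret_le π T).trans (mul_le_mul_of_nonneg_left h1 (by positivity))
      _ = A * (C * T * Real.log ((T + 2) / 2)
            + 32 * ε ^ 2 * T * ((T + 2) * Real.log ((T + 2) / 2))) := by ring
      _ ≤ A * (C * T * Real.log (4 * T) + 32 * ε ^ 2 * T * (T * Real.log (4 * T))) := by
          gcongr
      _ = _ := by
          rw [hC]
          ring
  rw [← Real.sqrt_mul (by positivity)]
  exact (le_abs_self _).trans (Real.abs_le_sqrt h3)
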